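/- Let $p\ge 3$ be an integer and let $a_m=1$ if $m\equiv 1 \pmod p$ and $a_m=0$ otherwise (partitions into parts congruent to $1$ modulo $p$). Write $e_k(w)=\exp(2\pi i w/k)$, $\mathrm{Li}_2(z)=\sum_{n\ge1}z^n/n^2$, and for $1\le t\le k$ let $D_{t,k}(s)=\sum_{m\ge 1}a_m e_k(mt)m^{-s}$, a Dirichlet series whose continuation has at most a simple pole at $s=1$. For $1\le j\le k$ put $$c_k(j)=\frac1k\sum_{t=1}^k e_k(-tj)\,\mathrm{Res}(D_{t,k},s=1),$$ and for coprime $1\le h\le k$ let $$L_{h,k}(z)=\sqrt{\sum_{j=1}^k c_k(j)\,\mathrm{Li}_2(e_k(jh)z)}\qquad(|z|<1)$$ with the principal square root, so that $\Re L_{h,k}\ge 0$. Let $$R(h,k)=\Bigl\{z:\ 0<|z|<1,\ \Re L_{h,k}(z)>\max_{(h',k')\ne(h,k)}\Re L_{h',k'}(z)\Bigr\},$$ where the maximum is over all coprime pairs $1\le h'\le k'$. For $1\le h\le p$ write $R(h,p)$ and $L_{h,p}$ for $R(h/d,p/d)$ and $L_{h/d,p/d}$, where $d=\gcd(h,p)$.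 Call a family of subsets $R_{(h,k)}$ of the open unit disk $\mathbb D$ (indexed by the coprime pairs $1\le h\le k$, with $R_{(h,k)}=\emptyset$ for the pairs that do not occur) a phase family if its sets are open and pairwise disjoint, only finitely many of them are nonempty, $\mathbb D$ is covered by these sets together with their boundaries, and $\Re L_{h,k}(z)>\max_{(h',k')\neq(h,k)}\Re L_{h',k'}(z)$ for all $z\in R_{(h,k)}$; the phases of the functions $L_{h,k}$ on $\mathbb D$ are the nonempty sets of a phase family that is maximal for inclusion. Theorem. (1) For $1\le h\le p$, the set $R(h,p)$ is the open sector $$\{re^{i\theta}:\ 0<r<1,\ |\theta+2\pi h/p|<\pi/p\}$$ of the unit disk, of opening $2\pi/p$ and centered at $\arg z=-2\pi h/p$. (2) $\overline{\mathbb D}=\bigcup_{h=1}^p\overline{R(h,p)}$. (3) No other function contributes: for every coprime pair $(h,k)$, $1\le h\le k$, with $k\nmid p$, the set $R(h,k)$ is empty; moreover, for every $z$ with $0<|z|<1$ one has $\Re L_{h,k}(z)<\max_{1\le h'\le p}\Re L_{h',p}(z)$. (4) The family of the sets $R(h,k)$ is the one and only maximal phase family; hence the phases of the functions $L_{h,k}$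 on $\mathbb D$ are exactly the $p$ sectors $R(1,p),\dots,R(p,p)$. -/

import Mathlib

open Complex Filter Topology

noncomputable section

namespace PartitionPhases

/-- The dilogarithm `Li₂(z) = ∑_{n ≥ 1} zⁿ / n²` for `|z| ≤ 1`. -/
def dilog (z : ℂ) : ℂ := ∑' n : ℕ, z ^ (n + 1) / ((n : ℂ) + 1) ^ 2

/-- `e_k(w) = exp(2 π i w / k)`. -/
def ek (k : ℕ) (w : ℂ) : ℂ := exp (2 * (Real.pi : ℂ) * I * w / (k : ℂ))

/-- The Dirichlet series `D_{t,k}(s) = ∑_{m ≥ 1} a_m e_k(m t) m^{-s}`, for `Re s > 1`. -/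
def dirichletD (a : ℕ → ℂ) (t k : ℕ) (s : ℂ) : ℂ :=
  LSeries (fun m => a m * ek k ((m : ℂ) * (t : ℂ))) s

/-- `Res(D_{t,k}, s = 1)`. The continuation of `D_{t,k}` has at most a simple pole at `1`, so that
its residue is the limit of `(s - 1) D_{t,k}(s)`, which is taken here through the half plane
`Re s > 1`, where `D_{t,k}` is given by its series. -/
def residueD (a : ℕ → ℂ) (t k : ℕ) : ℂ :=
  limUnder (𝓝[{s : ℂ | 1 < s.re}] (1 : ℂ)) (fun s => (s - 1) * dirichletD a t k s)

/-- `c_k(j) = (1/k) ∑_{t=1}^k e_k(-t j) Res(D_{t,k}, s = 1)`. -/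
def ck (a : ℕ → ℂ) (k j : ℕ) : ℂ :=
  1 / (k : ℂ) * ∑ t ∈ Finset.Icc 1 k, ek k (-((t : ℂ) * (j : ℂ))) * residueD a t k

/-- `L_{h,k}(z)`: the principal square root of `∑_{j=1}^k c_k(j) Li₂(e_k(j h) z)`,
whose real part is nonnegative. -/
def Lhk (a : ℕ → ℂ) (h k : ℕ) (z : ℂ) : ℂ :=
  (∑ j ∈ Finset.Icc 1 k, ck a k j * dilog (ek k ((j : ℂ) * (h : ℂ)) * z)) ^ (1 / 2 : ℂ)

/-- `Re L_m(z)` is strictly greater than `max {Re L_n(z) : n ≠ m}`. -/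
def Dominates {ι : Type*} (L : ι → ℂ → ℂ) (m : ι) (z : ℂ) : Prop :=
  ∃ M : ℝ, IsGreatest {x : ℝ | ∃ n : ι, n ≠ m ∧ x = (L n z).re} M ∧ M < (L m z).re

/-- `R` describes a decomposition of `U` into finitely many disjoint nonempty open sets `R m`,
together with their boundaries, such that `L m` dominates on `R m`. Indices `m` that do not occur
in the decomposition have `R m = ∅`. -/
structure IsPhaseFamily {ι : Type*} (L : ι → ℂ → ℂ) (U : Set ℂ) (R : ι → Set ℂ) : Prop where
  finite : {m | (R m).Nonempty}.Finite
  isOpen : ∀ m, IsOpen (R m)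
  subset : ∀ m, R m ⊆ U
  disjoint : Pairwise fun m n => Disjoint (R m) (R n)
  cover : U ⊆ ⋃ m, (R m ∪ frontier (R m))
  dominates : ∀ m, ∀ z ∈ R m, Dominates L m z

/-- The nonempty sets `R m` are the phases of the functions `L m` on `U`: they form a maximal
family (for inclusion) with the properties above. -/
def ArePhases {ι : Type*} (L : ι → ℂ → ℂ) (U : Set ℂ) (R : ι → Set ℂ) : Prop :=
  Maximal (IsPhaseFamily L U) R

/-- The pairs `(h, k)` with `1 ≤ h ≤ k` and `(h, k) = 1`, given as the fractions `h / k` in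
lowest terms. (So `h < k`, except for the pair `(1, 1)`.) -/
abbrev PhaseIndex : Type := {x : ℚ // 0 < x ∧ x ≤ 1}

/-- The fraction `h / p` with `1 ≤ h ≤ p`, not necessarily in lowest terms. -/
def fracIndex (p : ℕ) (h : Finset.Icc 1 p) : PhaseIndex :=
  ⟨((h : ℕ) : ℚ) / (p : ℚ), by
    obtain ⟨h, hh⟩ := h
    rw [Finset.mem_Icc] at hh
    have h1 : (0 : ℚ) < (h : ℚ) := by exact_mod_cast hh.1
    have h2 : (h : ℚ) ≤ (p : ℚ) := by exact_mod_cast hh.2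
    have h3 : (0 : ℚ) < (p : ℚ) := lt_of_lt_of_le h1 h2
    exact ⟨div_pos h1 h3, (div_le_one h3).2 h2⟩⟩

/-- Exponents for partitions into parts `≡ 1 mod p`. -/
def congOne (p : ℕ) (m : ℕ) : ℂ := if m % p = 1 % p then 1 else 0

/-- The functions `L_{h,k}` for partitions into parts `≡ 1 mod p`. -/
def phaseFun (p : ℕ) (x : PhaseIndex) : ℂ → ℂ :=
  Lhk (congOne p) x.1.num.toNat x.1.den

/-- `R(h,k)`: the nonzero points of the open unit disk where `Re L_{h,k}` is the (strict)
maximum. -/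
def phaseRegion (p : ℕ) (x : PhaseIndex) : Set ℂ :=
  {z | z ∈ Metric.ball (0 : ℂ) 1 ∧ z ≠ 0 ∧ Dominates (phaseFun p) x z}

/-- The open sector of the unit disk centered at `arg z = c` with opening `α`. -/
def sector (c α : ℝ) : Set ℂ :=
  {z | ∃ r θ : ℝ, 0 < r ∧ r < 1 ∧ |θ - c| < α / 2 ∧ z = (r : ℂ) * exp ((θ : ℂ) * I)}

end PartitionPhases

end

noncomputable section

namespace PartitionPhases

/-! For parts congruent to 1 modulo p, the coefficient c_k(j) is 1/(pk) times the number of i < k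
with 1 + pi ≡ j mod k. Summing the dilogarithm over these classes and applying its distribution
relation gives L_{h,k}(z)² = Li₂((e_k(h) z)^q) / (p q²) with q = k / gcd(p,k) (`Lhk_congOne`). Thus
k ∣ p means q = 1, and the candidates are the p rotations of one function √(Li₂/p).

Since (Re √w)² = (|w| + Re w)/2, these p functions are compared through H(r,α) = |Li₂(re^{iα})| + Re
Li₂(re^{iα}). For fixed r, H is strictly increasing in cos α (`dilogHeight_lt_of_cos_lt`): both Re
Li₂ and |Li₂|² are cosine series whose weights 1/n² come from integrating, twice, a geometric series
that is monotone in cos α. Hence the winner is the rotation that brings z nearest to the positive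
axis, which yields sectors of opening 2π/p.

If q ≥ 2, then (Re L)² ≤ r²π²/(24p). Because p ≥ 3, the best rotation leaves an angle of at most
π/3, and H(r,π/3) > r²π²/12 (`dilogHeight_pi_div_three_gt`) is exactly what is needed to beat that
bound. Finally, domination forces every phase family into the regions R(h,k), and these form a phase
family themselves, so they are the only maximal one. -/

/-! ### Positivity of power series with weights 1/n and 1/n². -/

/-- Since 1/(M+1+d) = ∫₀¹ u^{M+d} du, the weighted sum is the integral over u of u^M times the
unweighted sum at ux, which is positive. Applying this twice gives the squared weight. -/
lemma tsum_pow_mul_div_pos {b : ℕ → ℝ} {C : ℝ} (hb : ∀ d, |b d| ≤ C)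
    (hpos : ∀ x : ℝ, 0 < x → x < 1 → 0 < ∑' d, x ^ d * b d) (M : ℕ) {x : ℝ} (hx0 : 0 < x)
    (hx1 : x < 1) : 0 < ∑' d, x ^ d * (b d / ((M : ℝ) + 1 + d)) := by
  have hI : Set.uIoc (0 : ℝ) 1 = Set.Ioc 0 1 := Set.uIoc_of_le zero_le_one
  have hC : 0 ≤ C := (abs_nonneg _).trans (hb 0)
  have hterm : ∀ (d : ℕ) (u : ℝ), u ∈ Set.Icc (0 : ℝ) 1 →
      ‖u ^ M * ((u * x) ^ d * b d)‖ ≤ x ^ d * C := by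
    intro d u hu
    have h1 : u ^ M ≤ 1 := pow_le_one₀ hu.1 hu.2
    have h2 : (u * x) ^ d ≤ x ^ d :=
      pow_le_pow_left₀ (mul_nonneg hu.1 hx0.le) (mul_le_of_le_one_left hx0.le hu.2) d
    have h0 : 0 ≤ u ^ M := pow_nonneg hu.1 M
    have h3 : 0 ≤ (u * x) ^ d := pow_nonneg (mul_nonneg hu.1 hx0.le) d
    rw [Real.norm_eq_abs, abs_mul, abs_mul, abs_of_nonneg h0, abs_of_nonneg h3]
    calc u ^ M * ((u * x) ^ d * |b d|) ≤ 1 * (x ^ d * C) := by gcongr; exact hb d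
      _ = _ := one_mul _
  have hsum : Summable fun d : ℕ => x ^ d * C :=
    (summable_geometric_of_lt_one hx0.le hx1).mul_right C
  have hcont : ContinuousOn (fun u : ℝ => ∑' d, u ^ M * ((u * x) ^ d * b d)) (Set.Icc 0 1) :=
    continuousOn_tsum (fun d => by fun_prop) hsum fun d u hu => hterm d u hu
  have key : HasSum (fun d : ℕ => ∫ u in (0 : ℝ)..1, u ^ M * ((u * x) ^ d * b d))
      (∫ u in (0 : ℝ)..1, ∑' d, u ^ M * ((u * x) ^ d * b d)) := by
    refine intervalIntegral.hasSum_integral_of_dominated_convergence (fun d _ => x ^ d * C)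
      (fun d => ?_) (fun d => ?_) ?_ ?_ ?_
    · exact Continuous.aestronglyMeasurable (by fun_prop)
    · exact Eventually.of_forall fun u hu => hterm d u (Set.Ioc_subset_Icc_self (hI ▸ hu))
    · exact Eventually.of_forall fun u _ => hsum
    · exact intervalIntegrable_const
    · exact Eventually.of_forall fun u hu => (Summable.of_norm_bounded hsum fun d =>
        hterm d u (Set.Ioc_subset_Icc_self (hI ▸ hu))).hasSum
  have hval : ∀ d : ℕ, ∫ u in (0 : ℝ)..1, u ^ M * ((u * x) ^ d * b d) =
      x ^ d * (b d / ((M : ℝ) + 1 + d)) := by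
    intro d
    have : (fun u : ℝ => u ^ M * ((u * x) ^ d * b d)) = fun u => (x ^ d * b d) * u ^ (M + d) := by
      ext u; rw [mul_pow, pow_add]; ring
    rw [this, intervalIntegral.integral_const_mul, integral_pow]
    have : ((M : ℝ) + 1 + d) ≠ 0 := by positivity
    have h' : ((M : ℝ) + d + 1) ≠ 0 := by positivity
    push_cast
    simp only [one_pow, ne_eq, Nat.add_eq_zero_iff, one_ne_zero, and_false, not_false_eq_true,
      zero_pow, sub_zero]
    field_simp
    ring
  simp_rw [hval] at key
  rw [key.tsum_eq]
  refine intervalIntegral.intervalIntegral_pos_of_pos_on ?_ (fun u hu => ?_) zero_lt_one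
  · exact ContinuousOn.intervalIntegrable (by rwa [Set.uIcc_of_le zero_le_one])
  · rw [tsum_mul_left]
    have h1 : u * x < 1 := by nlinarith [hu.1, hu.2]
    exact mul_pos (pow_pos hu.1 M) (hpos _ (mul_pos hu.1 hx0) h1)

lemma tsum_pow_mul_div_sq_pos {b : ℕ → ℝ} {C : ℝ} (hb : ∀ d, |b d| ≤ C)
    (hpos : ∀ x : ℝ, 0 < x → x < 1 → 0 < ∑' d, x ^ d * b d) (M : ℕ) {x : ℝ} (hx0 : 0 < x)
    (hx1 : x < 1) : 0 < ∑' d, x ^ d * (b d / ((M : ℝ) + 1 + d) ^ 2) := by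
  have hb' : ∀ d, |b d / ((M : ℝ) + 1 + d)| ≤ C := by
    intro d
    have h : (1 : ℝ) ≤ (M : ℝ) + 1 + d := by
      have := Nat.cast_nonneg (α := ℝ) M
      have := Nat.cast_nonneg (α := ℝ) d
      linarith
    rw [abs_div, abs_of_pos (by linarith : (0 : ℝ) < (M : ℝ) + 1 + d)]
    exact (div_le_self (abs_nonneg _) h).trans (hb d)
  have := tsum_pow_mul_div_pos hb' (fun x h0 h1 => tsum_pow_mul_div_pos hb hpos M h0 h1) M hx0 hx1
  simpa only [div_div, ← sq] using this

/-- The real part of the geometric series at `x e^{iα}`. -/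
lemma hasSum_pow_mul_cos {x : ℝ} (hx0 : 0 ≤ x) (hx1 : x < 1) (α : ℝ) :
    HasSum (fun d : ℕ => x ^ d * Real.cos (d * α))
      ((1 - x * Real.cos α) / (1 - 2 * x * Real.cos α + x ^ 2)) := by
  have hn : ‖(x : ℂ) * exp (α * I)‖ < 1 := by
    rw [norm_mul, norm_exp_ofReal_mul_I, mul_one, norm_real, Real.norm_eq_abs, abs_of_nonneg hx0]
    exact hx1
  have h := Complex.hasSum_re (hasSum_geometric_of_norm_lt_one hn)
  have h1 : ∀ d : ℕ, (((x : ℂ) * exp (α * I)) ^ d).re = x ^ d * Real.cos (d * α) := by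
    intro d
    rw [mul_pow, ← exp_nat_mul, ← ofReal_pow, re_ofReal_mul, ← mul_assoc,
      ← ofReal_natCast, ← ofReal_mul, exp_ofReal_mul_I_re]
  simp_rw [h1] at h
  convert h using 1
  have hs := Real.sin_sq_add_cos_sq α
  rw [inv_re, normSq_apply]
  simp only [sub_re, sub_im, one_re, one_im, re_ofReal_mul, im_ofReal_mul, exp_ofReal_mul_I_re,
    exp_ofReal_mul_I_im]
  congr 1
  linear_combination -(x ^ 2) * hs

lemma tsum_pow_mul_cos_sub_pos {α β : ℝ} (h : Real.cos α < Real.cos β) {x : ℝ} (hx0 : 0 < x)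
    (hx1 : x < 1) :
    0 < ∑' d : ℕ, x ^ d * (Real.cos ((d + 1 : ℕ) * β) - Real.cos ((d + 1 : ℕ) * α)) := by
  have hs := (hasSum_pow_mul_cos hx0.le hx1 β).sub (hasSum_pow_mul_cos hx0.le hx1 α)
  have hs1 := (hasSum_nat_add_iff' 1).2 hs
  have h1 := hs1.mul_left x⁻¹
  have hterm : ∀ d : ℕ, x ^ d * (Real.cos ((d + 1 : ℕ) * β) - Real.cos ((d + 1 : ℕ) * α)) =
      x⁻¹ * (x ^ (d + 1) * Real.cos ((d + 1 : ℕ) * β) -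
        x ^ (d + 1) * Real.cos ((d + 1 : ℕ) * α)) := by
    intro d; field_simp; ring
  simp_rw [hterm]
  rw [h1.tsum_eq]
  refine mul_pos (inv_pos.2 hx0) ?_
  simp only [Finset.range_one, Finset.sum_singleton, pow_zero, Nat.cast_zero, zero_mul,
    Real.cos_zero, sub_self, sub_zero]
  have hα : 0 < 1 - 2 * x * Real.cos α + x ^ 2 := by
    nlinarith [Real.cos_le_one α, mul_pos hx0 (sub_pos.2 hx1), sq_nonneg (1 - x)]
  have hβ : 0 < 1 - 2 * x * Real.cos β + x ^ 2 := by
    nlinarith [Real.cos_le_one β, mul_pos hx0 (sub_pos.2 hx1), sq_nonneg (1 - x)]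
  rw [sub_pos, div_lt_div_iff₀ hα hβ, ← sub_pos]
  -- This product is the difference of the two cross-multiplied sides.
  have : 0 < x * (Real.cos β - Real.cos α) * (1 - x ^ 2) :=
    mul_pos (mul_pos hx0 (sub_pos.2 h)) (by nlinarith)
  linarith

/-- By symmetry the sum is twice its part above the diagonal, whose row m is parametrised by n = m +
1 + d. -/
lemma tsum_prod_nonneg_of_symm {G : ℕ × ℕ → ℝ} (hG : Summable G)
    (hsymm : ∀ m n, G (m, n) = G (n, m))
    (hdiag : ∀ n, G (n, n) = 0) (hrow : ∀ m, 0 ≤ ∑' d, G (m, m + 1 + d)) : 0 ≤ ∑' q, G q := by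
  set G₁ : ℕ × ℕ → ℝ := Set.indicator {q | q.1 < q.2} G
  set G₂ : ℕ × ℕ → ℝ := Set.indicator {q | q.2 < q.1} G
  have hs₁ : Summable G₁ := hG.indicator _
  have hs₂ : Summable G₂ := hG.indicator _
  have hsum : ∀ q, G q = G₁ q + G₂ q := by
    rintro ⟨m, n⟩
    rcases lt_trichotomy m n with h | h | h
    · simp [G₁, G₂, h, h.le]
    · subst h; simp [G₁, G₂, hdiag]
    · simp [G₁, G₂, h, h.le]
  have h21 : ∑' q, G₂ q = ∑' q, G₁ q := by
    rw [← (Equiv.prodComm ℕ ℕ).tsum_eq G₁]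
    refine tsum_congr ?_
    rintro ⟨m, n⟩
    simp only [G₁, G₂, Set.indicator_apply, Set.mem_ofPred_eq, Equiv.prodComm_apply, Prod.swap_prod_mk]
    rw [hsymm]
  let i : ℕ × ℕ → ℕ × ℕ := fun q => (q.1, q.1 + 1 + q.2)
  have hi : Function.Injective i := by
    rintro ⟨m, n⟩ ⟨m', n'⟩ h
    simp only [i, Prod.mk.injEq] at h ⊢
    omega
  have hsupp : Function.support G₁ ⊆ Set.range i := by
    rintro ⟨m, n⟩ h
    have : m < n := by
      by_contra hc
      exact h (by simp [G₁, hc])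
    exact ⟨(m, n - (m + 1)), by simp only [i, Prod.mk.injEq, true_and]; omega⟩
  have hval : ∀ q, G₁ (i q) = G (q.1, q.1 + 1 + q.2) := by
    rintro ⟨m, n⟩
    simp only [G₁, i, Set.indicator_apply, Set.mem_ofPred_eq]
    rw [if_pos (by omega)]
  have h1 : 0 ≤ ∑' q, G₁ q := by
    rw [← hi.tsum_eq hsupp]
    have hs : Summable fun q => G₁ (i q) := hs₁.comp_injective hi
    rw [hs.tsum_prod]
    refine tsum_nonneg fun m => ?_
    simpa only [hval] using hrow m
  rw [tsum_congr hsum, hs₁.tsum_add hs₂, h21]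
  linarith

/-! ### The dilogarithm in polar coordinates. -/

lemma hasSum_one_div_succ_sq : HasSum (fun n : ℕ => 1 / ((n : ℝ) + 1) ^ 2) (Real.pi ^ 2 / 6) := by
  have := (hasSum_nat_add_iff' 1).2 hasSum_zeta_two
  simpa using this

lemma norm_dilog_term_le {z : ℂ} (hz : ‖z‖ ≤ 1) (n : ℕ) :
    ‖z ^ (n + 1) / ((n : ℂ) + 1) ^ 2‖ ≤ ‖z‖ * (1 / ((n : ℝ) + 1) ^ 2) := by
  have h : ‖((n : ℂ) + 1)‖ = (n : ℝ) + 1 := by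
    rw [← Nat.cast_succ, norm_natCast, Nat.cast_succ]
  rw [norm_div, norm_pow, norm_pow, h, mul_one_div, pow_succ]
  gcongr
  exact mul_le_of_le_one_left (norm_nonneg _) (pow_le_one₀ (norm_nonneg _) hz)

lemma hasSum_dilog {z : ℂ} (hz : ‖z‖ ≤ 1) :
    HasSum (fun n : ℕ => z ^ (n + 1) / ((n : ℂ) + 1) ^ 2) (dilog z) :=
  (Summable.of_norm_bounded (hasSum_one_div_succ_sq.summable.mul_left ‖z‖)
    (norm_dilog_term_le hz)).hasSum

lemma norm_dilog_le {z : ℂ} (hz : ‖z‖ ≤ 1) : ‖dilog z‖ ≤ ‖z‖ * (Real.pi ^ 2 / 6) :=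
  tsum_of_norm_bounded (hasSum_one_div_succ_sq.mul_left ‖z‖) (norm_dilog_term_le hz)

lemma dilog_zero : dilog 0 = 0 := by
  simp [dilog]

/-- Twice the square of the real part of the principal square root of `Li₂(r e^{iα})`. -/
def dilogHeight (r α : ℝ) : ℝ :=
  ‖dilog (r * exp (α * I))‖ + (dilog (r * exp (α * I))).re

lemma norm_polar {r : ℝ} (hr : 0 ≤ r) (α : ℝ) : ‖(r : ℂ) * exp (α * I)‖ = r := by
  rw [norm_mul, norm_exp_ofReal_mul_I, mul_one, norm_real, Real.norm_eq_abs, abs_of_nonneg hr]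

lemma dilogHeight_nonneg (r α : ℝ) : 0 ≤ dilogHeight r α := by
  have := (abs_le.1 (abs_re_le_norm (dilog (r * exp (α * I))))).1
  unfold dilogHeight
  linarith

lemma dilog_polar_term (r α : ℝ) (n : ℕ) :
    ((r : ℂ) * exp (α * I)) ^ (n + 1) / ((n : ℂ) + 1) ^ 2 =
      ((r ^ (n + 1) / ((n : ℝ) + 1) ^ 2 : ℝ) : ℂ) * exp (((n + 1 : ℕ) * α : ℝ) * I) := by
  rw [mul_pow, ← exp_nat_mul]
  push_cast
  rw [← mul_assoc]
  ring

lemma hasSum_dilog_re {r : ℝ} (h0 : 0 ≤ r) (h1 : r ≤ 1) (α : ℝ) :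
    HasSum (fun n : ℕ => r ^ (n + 1) / ((n : ℝ) + 1) ^ 2 * Real.cos ((n + 1 : ℕ) * α))
      (dilog (r * exp (α * I))).re := by
  have h := Complex.hasSum_re (hasSum_dilog (z := r * exp (α * I)) (by rwa [norm_polar h0]))
  simpa only [dilog_polar_term, re_ofReal_mul, exp_ofReal_mul_I_re] using h

lemma hasSum_dilog_im {r : ℝ} (h0 : 0 ≤ r) (h1 : r ≤ 1) (α : ℝ) :
    HasSum (fun n : ℕ => r ^ (n + 1) / ((n : ℝ) + 1) ^ 2 * Real.sin ((n + 1 : ℕ) * α))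
      (dilog (r * exp (α * I))).im := by
  have h := Complex.hasSum_im (hasSum_dilog (z := r * exp (α * I)) (by rwa [norm_polar h0]))
  simpa only [dilog_polar_term, im_ofReal_mul, exp_ofReal_mul_I_im] using h

/-! ### Monotonicity of the height in the cosine of the angle. -/

lemma abs_cos_sub_cos_le (a b : ℝ) : |Real.cos a - Real.cos b| ≤ 2 := by
  rw [abs_le]
  constructor <;> linarith [Real.cos_le_one a, Real.cos_le_one b, Real.neg_one_le_cos a,
    Real.neg_one_le_cos b]

lemma dilog_re_lt_of_cos_lt {α β : ℝ} (h : Real.cos α < Real.cos β) {r : ℝ} (h0 : 0 < r)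
    (h1 : r < 1) : (dilog (r * exp (α * I))).re < (dilog (r * exp (β * I))).re := by
  have hs := ((hasSum_dilog_re h0.le h1.le β).sub (hasSum_dilog_re h0.le h1.le α)).tsum_eq
  have hp := tsum_pow_mul_div_sq_pos (C := 2)
    (b := fun d : ℕ => Real.cos ((d + 1 : ℕ) * β) - Real.cos ((d + 1 : ℕ) * α))
    (fun d => abs_cos_sub_cos_le _ _) (fun x hx0 hx1 => tsum_pow_mul_cos_sub_pos h hx0 hx1) 0 h0 h1
  rw [← sub_pos, ← hs]
  have := mul_pos h0 hp
  rw [← tsum_mul_left] at this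
  refine this.trans_eq (tsum_congr fun n => ?_)
  rw [Nat.cast_zero, zero_add, add_comm (1 : ℝ), pow_succ]
  ring

lemma hasSum_mul_self_of_summable_norm {f : ℕ → ℝ} {y : ℝ} (hf : HasSum f y)
    (hn : Summable fun n => ‖f n‖) : HasSum (fun q : ℕ × ℕ => f q.1 * f q.2) (y * y) :=
  hf.mul hf (summable_mul_of_summable_norm hn hn)

/-- Expanding re² + im² as double series, the products of cosines and sines combine into the cosine
of the difference of the angles. -/
lemma hasSum_norm_dilog_sq {r : ℝ} (h0 : 0 ≤ r) (h1 : r ≤ 1) (α : ℝ) :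
    HasSum (fun q : ℕ × ℕ => r ^ (q.1 + 1) / ((q.1 : ℝ) + 1) ^ 2 *
      (r ^ (q.2 + 1) / ((q.2 : ℝ) + 1) ^ 2) * Real.cos (((q.1 : ℝ) - q.2) * α))
      (‖dilog (r * exp (α * I))‖ ^ 2) := by
  have ha : Summable fun n : ℕ => r ^ (n + 1) / ((n : ℝ) + 1) ^ 2 := by
    refine Summable.of_nonneg_of_le (fun n => by positivity) (fun n => ?_)
      hasSum_one_div_succ_sq.summable
    gcongr
    exact pow_le_one₀ h0 h1
  have hsum : ∀ u : ℕ → ℝ, (∀ n, |u n| ≤ 1) →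
      Summable fun n : ℕ => ‖r ^ (n + 1) / ((n : ℝ) + 1) ^ 2 * u n‖ := by
    intro u hu
    refine Summable.of_nonneg_of_le (fun n => norm_nonneg _) (fun n => ?_) ha
    have : 0 ≤ r ^ (n + 1) / ((n : ℝ) + 1) ^ 2 := by positivity
    rw [Real.norm_eq_abs, abs_mul, abs_of_nonneg this]
    exact mul_le_of_le_one_right this (hu n)
  have hsq : ∀ (u : ℕ → ℝ) (y : ℝ), (∀ n, |u n| ≤ 1) →
      HasSum (fun n : ℕ => r ^ (n + 1) / ((n : ℝ) + 1) ^ 2 * u n) y →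
      HasSum (fun q : ℕ × ℕ => r ^ (q.1 + 1) / ((q.1 : ℝ) + 1) ^ 2 * u q.1 *
        (r ^ (q.2 + 1) / ((q.2 : ℝ) + 1) ^ 2 * u q.2)) (y * y) := by
    intro u y hu hy
    exact hasSum_mul_self_of_summable_norm hy (hsum u hu)
  have hc := hsq _ _ (fun n => Real.abs_cos_le_one _) (hasSum_dilog_re h0 h1 α)
  have hs := hsq _ _ (fun n => Real.abs_sin_le_one _) (hasSum_dilog_im h0 h1 α)
  have hadd := hc.add hs
  rw [← normSq_apply, ← Complex.sq_norm] at hadd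
  have hterm : ∀ q : ℕ × ℕ, r ^ (q.1 + 1) / ((q.1 : ℝ) + 1) ^ 2 *
      (r ^ (q.2 + 1) / ((q.2 : ℝ) + 1) ^ 2) * Real.cos (((q.1 : ℝ) - q.2) * α) =
      r ^ (q.1 + 1) / ((q.1 : ℝ) + 1) ^ 2 * Real.cos ((q.1 + 1 : ℕ) * α) *
        (r ^ (q.2 + 1) / ((q.2 : ℝ) + 1) ^ 2 * Real.cos ((q.2 + 1 : ℕ) * α)) +
      r ^ (q.1 + 1) / ((q.1 : ℝ) + 1) ^ 2 * Real.sin ((q.1 + 1 : ℕ) * α) *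
        (r ^ (q.2 + 1) / ((q.2 : ℝ) + 1) ^ 2 * Real.sin ((q.2 + 1 : ℕ) * α)) := by
    intro q
    have : ((q.1 : ℝ) - q.2) * α = (q.1 + 1 : ℕ) * α - (q.2 + 1 : ℕ) * α := by push_cast; ring
    rw [this, Real.cos_sub]
    generalize r ^ (q.1 + 1) / ((q.1 : ℝ) + 1) ^ 2 = a
    generalize r ^ (q.2 + 1) / ((q.2 : ℝ) + 1) ^ 2 = b
    ring
  rw [funext hterm]
  exact hadd

lemma norm_dilog_le_of_cos_lt {α β : ℝ} (h : Real.cos α < Real.cos β) {r : ℝ} (h0 : 0 < r)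
    (h1 : r < 1) : ‖dilog (r * exp (α * I))‖ ≤ ‖dilog (r * exp (β * I))‖ := by
  refine le_of_sq_le_sq ?_ (norm_nonneg _)
  have hs := (hasSum_norm_dilog_sq h0.le h1.le β).sub (hasSum_norm_dilog_sq h0.le h1.le α)
  rw [← sub_nonneg, ← hs.tsum_eq]
  refine tsum_prod_nonneg_of_symm hs.summable (fun m n => ?_) (fun n => by simp) fun m => ?_
  · rw [← Real.cos_neg (((m : ℝ) - n) * β), ← Real.cos_neg (((m : ℝ) - n) * α)]
    rw [show -(((m : ℝ) - n) * β) = ((n : ℝ) - m) * β by ring,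
      show -(((m : ℝ) - n) * α) = ((n : ℝ) - m) * α by ring]
    ring
  -- In row m the second index is n = m + 1 + d, so its weight is 1/(m+2+d)², which is the case M =
  -- m + 1.
  · have hp := tsum_pow_mul_div_sq_pos (C := 2)
      (b := fun d : ℕ => Real.cos ((d + 1 : ℕ) * β) - Real.cos ((d + 1 : ℕ) * α))
      (fun d => abs_cos_sub_cos_le _ _) (fun x hx0 hx1 => tsum_pow_mul_cos_sub_pos h hx0 hx1)
      (m + 1) h0 h1
    have hw : 0 < r ^ (m + 1) / ((m : ℝ) + 1) ^ 2 * r ^ (m + 2) := by positivity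
    have := mul_pos hw hp
    rw [← tsum_mul_left] at this
    refine (this.trans_eq (tsum_congr fun d => ?_)).le
    simp only
    have hcos : ∀ γ : ℝ, Real.cos (((m : ℝ) - (m + 1 + d : ℕ)) * γ) =
        Real.cos ((d + 1 : ℕ) * γ) := by
      intro γ
      rw [← Real.cos_neg]
      congr 1
      push_cast
      ring
    rw [hcos, hcos]
    push_cast
    rw [show (m : ℝ) + 1 + d + 1 = m + 1 + 1 + d by ring]
    ring

lemma dilogHeight_lt_of_cos_lt {α β : ℝ} (h : Real.cos α < Real.cos β) {r : ℝ} (h0 : 0 < r)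
    (h1 : r < 1) : dilogHeight r α < dilogHeight r β :=
  add_lt_add_of_le_of_lt (norm_dilog_le_of_cos_lt h h0 h1) (dilog_re_lt_of_cos_lt h h0 h1)

/-- Equal cosines mean α = ±β modulo 2π, and the height is even and 2π-periodic in the angle. -/
lemma dilogHeight_eq_of_cos_eq {α β : ℝ} (h : Real.cos α = Real.cos β) (r : ℝ) (h0 : 0 ≤ r)
    (h1 : r ≤ 1) : dilogHeight r α = dilogHeight r β := by
  have key : ∀ γ : ℝ, dilogHeight r (-γ) = dilogHeight r γ := by
    intro γ
    have hre : (dilog (r * exp ((-γ : ℝ) * I))).re = (dilog (r * exp (γ * I))).re := by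
      rw [← (hasSum_dilog_re h0 h1 _).tsum_eq, ← (hasSum_dilog_re h0 h1 _).tsum_eq]
      simp only [mul_neg, Real.cos_neg]
    have hsq : ‖dilog (r * exp ((-γ : ℝ) * I))‖ ^ 2 = ‖dilog (r * exp (γ * I))‖ ^ 2 := by
      rw [← (hasSum_norm_dilog_sq h0 h1 _).tsum_eq, ← (hasSum_norm_dilog_sq h0 h1 _).tsum_eq]
      simp only [mul_neg, Real.cos_neg]
    have hn := (sq_eq_sq₀ (norm_nonneg _) (norm_nonneg _)).1 hsq
    rw [dilogHeight, dilogHeight, hre, hn]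
  have hper : ∀ (γ : ℝ) (k : ℤ), dilogHeight r (2 * k * Real.pi + γ) = dilogHeight r γ := by
    intro γ k
    have : exp (((2 * k * Real.pi + γ : ℝ) : ℂ) * I) = exp (γ * I) := by
      rw [exp_eq_exp_iff_exists_int]
      exact ⟨k, by push_cast; ring⟩
    rw [dilogHeight, dilogHeight, this]
  obtain ⟨k, hk | hk⟩ := Real.cos_eq_cos_iff.1 h
  · rw [hk, hper]
  · rw [hk, sub_eq_add_neg, hper, key]

lemma dilogHeight_le_of_cos_le {α β : ℝ} (h : Real.cos α ≤ Real.cos β) {r : ℝ} (h0 : 0 < r)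
    (h1 : r < 1) : dilogHeight r α ≤ dilogHeight r β := by
  rcases h.lt_or_eq with h | h
  · exact (dilogHeight_lt_of_cos_lt h h0 h1).le
  · exact (dilogHeight_eq_of_cos_eq h r h0.le h1.le).le

/-! ### Roots of unity, residues and the coefficients c_k(j). -/

lemma ek_add (k : ℕ) (v w : ℂ) : ek k (v + w) = ek k v * ek k w := by
  rw [ek, ek, ek, ← exp_add]
  congr 1
  ring

lemma ek_mul_natCast (k : ℕ) (w : ℂ) (n : ℕ) : ek k (w * n) = ek k w ^ n := by
  rw [ek, ek, ← exp_nat_mul]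
  congr 1
  ring

lemma ek_intCast_eq_one_iff {k : ℕ} (hk : k ≠ 0) (m : ℤ) : ek k m = 1 ↔ (k : ℤ) ∣ m := by
  have hk' : (k : ℂ) ≠ 0 := Nat.cast_ne_zero.2 hk
  have h2 : 2 * (Real.pi : ℂ) * I ≠ 0 := two_pi_I_ne_zero
  rw [ek, exp_eq_one_iff]
  constructor
  · rintro ⟨n, hn⟩
    refine ⟨n, ?_⟩
    have h3 : 2 * (Real.pi : ℂ) * I * m = 2 * (Real.pi : ℂ) * I * (k * n) := by
      rw [div_eq_iff hk'] at hn
      rw [hn]; ring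
    exact_mod_cast mul_left_cancel₀ h2 h3
  · rintro ⟨n, rfl⟩
    refine ⟨n, ?_⟩
    push_cast
    field_simp

lemma ek_eq_of_dvd_sub {k : ℕ} (hk : k ≠ 0) {m n : ℤ} (h : (k : ℤ) ∣ m - n) : ek k m = ek k n := by
  have h1 := (ek_intCast_eq_one_iff hk _).2 h
  have : (m : ℂ) = n + (m - n : ℤ) := by push_cast; ring
  rw [this, ek_add, h1, mul_one]

lemma norm_ek_natCast (k h : ℕ) : ‖ek k h‖ = 1 := by
  have : 2 * (Real.pi : ℂ) * I * h / k = ((2 * Real.pi * h / k : ℝ) : ℂ) * I := by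
    push_cast; ring
  rw [ek, this, norm_exp_ofReal_mul_I]

lemma sum_range_ek {k : ℕ} (hk : k ≠ 0) (m : ℤ) :
    ∑ t ∈ Finset.range k, ek k (m * t) = if (k : ℤ) ∣ m then (k : ℂ) else 0 := by
  simp_rw [ek_mul_natCast]
  split_ifs with h
  · simp [(ek_intCast_eq_one_iff hk m).2 h]
  · have h1 : ek k m ≠ 1 := fun hc => h ((ek_intCast_eq_one_iff hk m).1 hc)
    have h2 : ek k m ^ k = 1 := by
      rw [← ek_mul_natCast, ← Int.cast_natCast, ← Int.cast_mul, ek_intCast_eq_one_iff hk]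
      exact dvd_mul_left _ _
    rw [geom_sum_eq h1, h2, sub_self, zero_div]

lemma sum_Icc_ek {k : ℕ} (hk : k ≠ 0) (m : ℤ) :
    ∑ t ∈ Finset.Icc 1 k, ek k (m * t) = if (k : ℤ) ∣ m then (k : ℂ) else 0 := by
  have h1 : Finset.Icc 1 k = Finset.Ico 1 (k + 1) := by ext; simp
  rw [h1, Finset.sum_Ico_eq_sum_range, Nat.add_sub_cancel]
  have h2 : ∀ t : ℕ, ek k (m * ((1 + t : ℕ) : ℂ)) = ek k m * ek k (m * t) := by
    intro t
    rw [← ek_add]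
    congr 1
    push_cast; ring
  simp_rw [h2]
  rw [← Finset.mul_sum, sum_range_ek hk]
  split_ifs with h
  · rw [(ek_intCast_eq_one_iff hk m).2 h, one_mul]
  · rw [mul_zero]

/-- The coefficients are periodic modulo pk, so the residue is their mean over one period. Only the
classes 1 + pi with i < k contribute. -/
lemma residueD_congOne {p k : ℕ} (hp : 2 ≤ p) (hk : k ≠ 0) (t : ℕ) :
    residueD (congOne p) t k =
      1 / ((p : ℂ) * k) * ∑ i ∈ Finset.range k, ek k (((1 + p * i : ℕ) : ℂ) * t) := by
  have hp0 : p ≠ 0 := by omega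
  have : NeZero (p * k) := ⟨mul_ne_zero hp0 hk⟩
  let Φ : ZMod (p * k) → ℂ := fun j => congOne p j.val * ek k ((j.val : ℂ) * t)
  have hΦ : ∀ m : ℕ, Φ m = congOne p m * ek k ((m : ℂ) * t) := by
    intro m
    simp only [Φ, ZMod.val_natCast]
    congr 1
    · simp only [congOne, Nat.mod_mod_of_dvd m (dvd_mul_right p k)]
    · have hd : (k : ℤ) ∣ ((m % (p * k) : ℕ) * t : ℤ) - (m * t : ℤ) := by
        rw [← sub_mul]
        refine dvd_mul_of_dvd_left ?_ _
        have : (m : ℤ) = (m % (p * k) : ℕ) + (p * k : ℤ) * (m / (p * k) : ℕ) := by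
          exact_mod_cast (Nat.mod_add_div m (p * k)).symm
        refine ⟨-(p * (m / (p * k) : ℕ)), ?_⟩
        linear_combination -this
      have := ek_eq_of_dvd_sub hk hd
      push_cast at this ⊢
      exact this
  have hmem : {s : ℂ | 1 < s.re} ⊆ {1}ᶜ := by
    intro s hs h1
    rw [Set.mem_singleton_iff.1 h1] at hs
    simp at hs
  -- The point 1 lies in the closure of the half plane, so limits along this filter are unique and
  -- `limUnder` takes the true value.
  have hne : (𝓝[{s : ℂ | 1 < s.re}] (1 : ℂ)).NeBot := by
    rw [← mem_closure_iff_nhdsWithin_neBot, closure_setOfPred_lt_re]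
    simp
  have hlim := (ZMod.LFunction_residue_one Φ).mono_left (nhdsWithin_mono _ hmem)
  have hlim' : Tendsto (fun s => (s - 1) * dirichletD (congOne p) t k s)
      (𝓝[{s : ℂ | 1 < s.re}] (1 : ℂ)) (𝓝 (∑ j, Φ j / (p * k : ℕ))) := by
    refine hlim.congr' ?_
    filter_upwards [self_mem_nhdsWithin] with s hs
    rw [ZMod.LFunction_eq_LSeries Φ hs, dirichletD]
    simp only [hΦ]
  rw [residueD, hlim'.limUnder_eq, ← Finset.sum_div, div_eq_inv_mul, one_div]
  push_cast
  congr 1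
  symm
  refine Finset.sum_of_injOn (fun i : ℕ => ((1 + p * i : ℕ) : ZMod (p * k))) ?_ (by simp) ?_ ?_
  · intro i hi j hj hij
    simp only [Finset.coe_range, Set.mem_Iio] at hi hj
    have h := (ZMod.natCast_eq_natCast_iff' _ _ _).1 hij
    have hlt : ∀ i < k, 1 + p * i < p * k := by
      intro i hi
      calc 1 + p * i < p + p * i := by omega
        _ = p * (i + 1) := by ring
        _ ≤ p * k := Nat.mul_le_mul_left p hi
    rw [Nat.mod_eq_of_lt (hlt i hi), Nat.mod_eq_of_lt (hlt j hj)] at h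
    exact Nat.eq_of_mul_eq_mul_left (by omega) (by omega : p * i = p * j)
  · intro j _ hj
    have h0 : ¬ j.val % p = 1 % p := by
      intro hc
      refine hj ⟨j.val / p, ?_, ?_⟩
      · simp only [Finset.coe_range, Set.mem_Iio]
        exact Nat.div_lt_of_lt_mul (ZMod.val_lt j)
      · have : 1 + p * (j.val / p) = j.val := by
          rw [← Nat.mod_eq_of_lt (show 1 < p by omega), ← hc, Nat.mod_add_div]
        simp only [this, ZMod.natCast_val, ZMod.cast_id', id_eq]
    simp [Φ, congOne, h0]
  · intro i _
    rw [hΦ]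
    simp [congOne]

/-- The sum over t is the finite Fourier inversion of the residues; orthogonality of characters
turns it into a count. -/
lemma ck_congOne {p k : ℕ} (hp : 2 ≤ p) (hk : k ≠ 0) (j : ℕ) :
    ck (congOne p) k j = 1 / ((p : ℂ) * k) *
      ∑ i ∈ Finset.range k, if (k : ℤ) ∣ ((1 + p * i : ℕ) : ℤ) - j then (1 : ℂ) else 0 := by
  have hk' : (k : ℂ) ≠ 0 := Nat.cast_ne_zero.2 hk
  rw [ck]
  simp_rw [residueD_congOne hp hk, Finset.mul_sum]
  rw [Finset.sum_comm]
  refine Finset.sum_congr rfl fun i _ => ?_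
  have h1 : ∀ t : ℕ, 1 / (k : ℂ) * (ek k (-((t : ℂ) * j)) *
      (1 / ((p : ℂ) * k) * ek k (((1 + p * i : ℕ) : ℂ) * t))) =
      1 / ((p : ℂ) * k) * (1 / (k : ℂ)) * ek k ((((1 + p * i : ℕ) : ℤ) - j : ℤ) * t) := by
    intro t
    have : ((((1 + p * i : ℕ) : ℤ) - j : ℤ) : ℂ) * t =
        -((t : ℂ) * j) + ((1 + p * i : ℕ) : ℂ) * t := by push_cast; ring
    rw [this, ek_add]
    ring
  simp_rw [h1]
  rw [← Finset.mul_sum, sum_Icc_ek hk, mul_assoc]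
  congr 1
  split_ifs
  · exact one_div_mul_cancel hk'
  · rw [mul_zero]

lemma sum_Icc_ite_dvd_sub_mul {k : ℕ} (hk : k ≠ 0) (G : ℕ → ℂ)
    (hG : ∀ m n : ℕ, (k : ℤ) ∣ (m : ℤ) - n → G m = G n) (m : ℕ) :
    ∑ j ∈ Finset.Icc 1 k, (if (k : ℤ) ∣ (m : ℤ) - j then (1 : ℂ) else 0) * G j = G m := by
  -- The representative of m in {1, …, k} is (m + k - 1) % k + 1; adding k keeps the natural
  -- subtraction exact at m = 0.
  have hlt := Nat.mod_lt (m + k - 1) (Nat.pos_of_ne_zero hk)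
  have hdiv := Nat.mod_add_div (m + k - 1) k
  set c := (m + k - 1) / k
  set b := (m + k - 1) % k
  have hd : (k : ℤ) ∣ (m : ℤ) - (b + 1 : ℕ) := by
    refine ⟨(c : ℤ) - 1, ?_⟩
    have : (b : ℤ) + k * c = m + k - 1 := by
      have : b + k * c + 1 = m + k := by omega
      have : (b : ℤ) + k * c + 1 = m + k := by exact_mod_cast this
      linarith
    push_cast
    linear_combination -this
  rw [Finset.sum_eq_single (b + 1)]
  · rw [if_pos hd, one_mul, hG m _ hd]
  · intro j hj hne
    rw [Finset.mem_Icc] at hj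
    rw [if_neg, zero_mul]
    intro hc
    have h2 := dvd_sub hc hd
    rw [sub_sub_sub_cancel_left] at h2
    have h3 : ((b + 1 : ℕ) : ℤ) - j = 0 := by
      refine Int.eq_zero_of_abs_lt_dvd h2 ?_
      rw [abs_lt]
      constructor <;> push_cast <;> omega
    omega
  · intro h
    exact absurd (Finset.mem_Icc.2 ⟨by omega, by omega⟩) h

lemma sum_ck_mul {p k : ℕ} (hp : 2 ≤ p) (hk : k ≠ 0) (G : ℕ → ℂ)
    (hG : ∀ m n : ℕ, (k : ℤ) ∣ (m : ℤ) - n → G m = G n) :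
    ∑ j ∈ Finset.Icc 1 k, ck (congOne p) k j * G j =
      1 / ((p : ℂ) * k) * ∑ i ∈ Finset.range k, G (1 + p * i) := by
  simp_rw [ck_congOne hp hk, mul_assoc, Finset.sum_mul]
  rw [← Finset.mul_sum, Finset.sum_comm]
  congr 1
  exact Finset.sum_congr rfl fun i _ => sum_Icc_ite_dvd_sub_mul hk G hG _

/-! ### The closed form of L_{h,k}. -/

/-- The distribution relation of the dilogarithm. -/
lemma hasSum_dilog_multisection {q : ℕ} (hq : q ≠ 0) {w : ℂ} (hw : ‖w‖ ≤ 1) :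
    HasSum (fun n : ℕ => if q ∣ n + 1 then w ^ (n + 1) / ((n : ℂ) + 1) ^ 2 else 0)
      (1 / (q : ℂ) ^ 2 * dilog (w ^ q)) := by
  have hqc : (q : ℂ) ≠ 0 := Nat.cast_ne_zero.2 hq
  have hwq : ‖w ^ q‖ ≤ 1 := by rw [norm_pow]; exact pow_le_one₀ (norm_nonneg _) hw
  let e : ℕ → ℕ := fun n => q * (n + 1) - 1
  have he : ∀ n, e n + 1 = q * (n + 1) := fun n =>
    Nat.sub_add_cancel (Nat.mul_pos (Nat.pos_of_ne_zero hq) n.succ_pos)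
  have hinj : Function.Injective e := by
    intro m n h
    have : q * (m + 1) = q * (n + 1) := by rw [← he, ← he, h]
    simpa using Nat.eq_of_mul_eq_mul_left (Nat.pos_of_ne_zero hq) this
  rw [← hinj.hasSum_iff]
  · refine ((hasSum_dilog hwq).mul_left (1 / (q : ℂ) ^ 2)).congr_fun fun n => ?_
    have hc : ((e n : ℕ) : ℂ) + 1 = q * (n + 1) := by exact_mod_cast he n
    simp only [Function.comp, he, dvd_mul_right, if_true, hc]
    have : (n : ℂ) + 1 ≠ 0 := by exact_mod_cast n.succ_ne_zero
    rw [pow_mul]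
    field_simp
  · intro n hn
    rw [if_neg]
    rintro ⟨c, hc⟩
    rcases c with _ | c
    · simp at hc
    · refine hn ⟨c, ?_⟩
      have := he c
      omega

/-- The order of `p` times a fraction with denominator `k`. -/
def reducedDen (p k : ℕ) : ℕ := k / Nat.gcd p k

lemma dvd_mul_iff_reducedDen_dvd {p k h : ℕ} (hk : k ≠ 0) (hhk : Nat.Coprime h k) (n : ℕ) :
    k ∣ p * h * n ↔ reducedDen p k ∣ n := by
  have hg : 0 < Nat.gcd p k := Nat.gcd_pos_of_pos_right p (Nat.pos_of_ne_zero hk)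
  rw [reducedDen, mul_right_comm, hhk.symm.dvd_mul_right]
  constructor
  · intro h1
    have h2 : k / p.gcd k ∣ p / p.gcd k * n := by
      refine (Nat.mul_dvd_mul_iff_left hg).1 ?_
      rwa [← mul_assoc, Nat.mul_div_cancel' (Nat.gcd_dvd_right p k),
        Nat.mul_div_cancel' (Nat.gcd_dvd_left p k)]
    exact (Nat.coprime_div_gcd_div_gcd hg).symm.dvd_of_dvd_mul_left h2
  · intro h1
    calc k = p.gcd k * (k / p.gcd k) := (Nat.mul_div_cancel' (Nat.gcd_dvd_right p k)).symm
      _ ∣ p * n := mul_dvd_mul (Nat.gcd_dvd_left p k) h1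

lemma reducedDen_ne_zero {k : ℕ} (p : ℕ) (hk : k ≠ 0) : reducedDen p k ≠ 0 :=
  (Nat.div_pos (Nat.gcd_le_right p (Nat.pos_of_ne_zero hk))
    (Nat.gcd_pos_of_pos_right p (Nat.pos_of_ne_zero hk))).ne'

lemma le_mul_reducedDen {p : ℕ} (hp : p ≠ 0) (k : ℕ) : k ≤ p * reducedDen p k := by
  conv_lhs => rw [← Nat.mul_div_cancel' (Nat.gcd_dvd_right p k)]
  exact Nat.mul_le_mul_right _ (Nat.gcd_le_left k (Nat.pos_of_ne_zero hp))

lemma Lhk_congOne {p k h : ℕ} (hp : 2 ≤ p) (hk : k ≠ 0) (hhk : Nat.Coprime h k) {z : ℂ}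
    (hz : ‖z‖ ≤ 1) :
    Lhk (congOne p) h k z = (1 / ((p : ℂ) * (reducedDen p k : ℂ) ^ 2) *
      dilog ((ek k h * z) ^ reducedDen p k)) ^ (1 / 2 : ℂ) := by
  have hk' : (k : ℂ) ≠ 0 := Nat.cast_ne_zero.2 hk
  rw [Lhk]
  congr 1
  have hG : ∀ m n : ℕ, (k : ℤ) ∣ (m : ℤ) - n →
      dilog (ek k ((m : ℂ) * h) * z) = dilog (ek k ((n : ℂ) * h) * z) := by
    intro m n hmn
    have := ek_eq_of_dvd_sub hk (m := m * h) (n := n * h) (by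
      rw [← sub_mul]; exact dvd_mul_of_dvd_left hmn _)
    push_cast at this
    rw [this]
  rw [sum_ck_mul hp hk (fun j => dilog (ek k ((j : ℂ) * h) * z)) hG]
  have hnorm : ∀ i : ℕ, ‖ek k (((1 + p * i : ℕ) : ℂ) * h) * z‖ ≤ 1 := by
    intro i
    rw [norm_mul, ← Nat.cast_mul, norm_ek_natCast, one_mul]
    exact hz
  have hw : ‖ek k h * z‖ ≤ 1 := by rwa [norm_mul, norm_ek_natCast, one_mul]
  have hs := hasSum_sum (s := Finset.range k) fun i _ => hasSum_dilog (hnorm i)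
  -- The sum over i of e_k(p h (n+1) i) keeps only the exponents with k ∣ p h (n+1), that is, the
  -- multiples of q.
  have hterm : ∀ n : ℕ, ∑ i ∈ Finset.range k,
      (ek k (((1 + p * i : ℕ) : ℂ) * h) * z) ^ (n + 1) / ((n : ℂ) + 1) ^ 2 =
      (k : ℂ) * (if reducedDen p k ∣ n + 1 then (ek k h * z) ^ (n + 1) / ((n : ℂ) + 1) ^ 2 else 0) := by
    intro n
    have h1 : ∀ i : ℕ, (ek k (((1 + p * i : ℕ) : ℂ) * h) * z) ^ (n + 1) / ((n : ℂ) + 1) ^ 2 =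
        (ek k h * z) ^ (n + 1) / ((n : ℂ) + 1) ^ 2 *
          ek k (((p * h * (n + 1) : ℕ) : ℤ) * i) := by
      intro i
      have h2 : ((1 + p * i : ℕ) : ℂ) * h = h + (p * i * h : ℂ) := by push_cast; ring
      have h3 : (((p * h * (n + 1) : ℕ) : ℤ) : ℂ) * i = (p * i * h : ℂ) * (n + 1 : ℕ) := by
        push_cast; ring
      rw [h2, ek_add, h3, ek_mul_natCast k (p * i * h : ℂ)]
      ring
    simp_rw [h1]
    rw [← Finset.mul_sum, sum_range_ek hk]
    simp only [Int.natCast_dvd_natCast, dvd_mul_iff_reducedDen_dvd hk hhk]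
    split_ifs <;> ring
  simp_rw [hterm] at hs
  have := hs.unique ((hasSum_dilog_multisection (reducedDen_ne_zero p hk) hw).mul_left (k : ℂ))
  rw [this]
  have hp' : (p : ℂ) ≠ 0 := Nat.cast_ne_zero.2 (by omega)
  field_simp

/-! ### Real parts of the phase functions; denominators dividing p. -/

lemma re_cpow_half (w : ℂ) : (w ^ (1 / 2 : ℂ)).re = √((‖w‖ + w.re) / 2) := by
  rw [one_div, cpow_inv_two_re]

lemma phaseFun_eq {p : ℕ} (hp : 2 ≤ p) (x : PhaseIndex) {z : ℂ} (hz : ‖z‖ ≤ 1) :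
    phaseFun p x z = (1 / ((p : ℂ) * (reducedDen p x.1.den : ℂ) ^ 2) *
      dilog ((exp (2 * Real.pi * (x.1 : ℝ) * I) * z) ^ reducedDen p x.1.den)) ^ (1 / 2 : ℂ) := by
  have hnum : ((x.1.num.toNat : ℕ) : ℤ) = x.1.num := Int.toNat_of_nonneg (Rat.num_pos.2 x.2.1).le
  have hcop : Nat.Coprime x.1.num.toNat x.1.den := by
    have := x.1.reduced
    rwa [← hnum, Int.natAbs_natCast] at this
  rw [phaseFun, Lhk_congOne hp x.1.den_nz hcop hz]
  have : ek x.1.den (x.1.num.toNat : ℕ) = exp (2 * Real.pi * (x.1 : ℝ) * I) := by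
    rw [ek]
    congr 1
    have h1 : ((x.1.num.toNat : ℕ) : ℂ) = (x.1.num : ℂ) := by exact_mod_cast congrArg (Int.cast (R := ℂ)) hnum
    have h2 : ((x.1 : ℝ) : ℂ) = (x.1.num : ℂ) / x.1.den := by
      rw [ofReal_ratCast]
      exact_mod_cast Rat.cast_def (K := ℂ) x.1
    rw [h1, h2]
    ring
  rw [this]

lemma phaseFun_re_nonneg {p : ℕ} (x : PhaseIndex) (z : ℂ) : 0 ≤ (phaseFun p x z).re := by
  rw [phaseFun, Lhk, re_cpow_half]
  exact Real.sqrt_nonneg _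

lemma norm_exp_two_pi_mul_I (x : ℝ) : ‖exp (2 * Real.pi * x * I)‖ = 1 := by
  have : (2 * Real.pi * x * I : ℂ) = ((2 * Real.pi * x : ℝ) : ℂ) * I := by push_cast; ring
  rw [this, norm_exp_ofReal_mul_I]

lemma phaseFun_re_sq_le {p : ℕ} (hp : 2 ≤ p) (x : PhaseIndex) {z : ℂ} (hz : ‖z‖ ≤ 1) :
    (phaseFun p x z).re ^ 2 ≤ 1 / ((p : ℝ) * (reducedDen p x.1.den : ℝ) ^ 2) *
      (‖z‖ ^ reducedDen p x.1.den * (Real.pi ^ 2 / 6)) := by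
  rw [phaseFun_eq hp x hz, re_cpow_half]
  set q := reducedDen p x.1.den
  set w := 1 / ((p : ℂ) * (q : ℂ) ^ 2) * dilog ((exp (2 * Real.pi * (x.1 : ℝ) * I) * z) ^ q) with hw
  have hre := abs_le.1 (abs_re_le_norm w)
  rw [Real.sq_sqrt (by linarith [hre.1])]
  have hn : ‖(exp (2 * Real.pi * (x.1 : ℝ) * I) * z) ^ q‖ = ‖z‖ ^ q := by
    rw [norm_pow, norm_mul, norm_exp_two_pi_mul_I, one_mul]
  have h1 : ‖w‖ ≤ 1 / ((p : ℝ) * (q : ℝ) ^ 2) * (‖z‖ ^ q * (Real.pi ^ 2 / 6)) := by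
    rw [hw, norm_mul, norm_div, norm_one, norm_mul, norm_pow, norm_natCast, norm_natCast]
    gcongr
    rw [← hn]
    exact norm_dilog_le (by rw [hn]; exact pow_le_one₀ (norm_nonneg _) hz)
  linarith [hre.2]

lemma reducedDen_fracIndex {p : ℕ} (h : Finset.Icc 1 p) :
    reducedDen p (fracIndex p h).1.den = 1 := by
  have hd : (fracIndex p h).1.den ∣ p := by
    have := Rat.den_dvd ((h : ℕ) : ℤ) p
    rw [Int.natCast_dvd_natCast, Rat.divInt_eq_div, Int.cast_natCast, Int.cast_natCast] at this
    exact this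
  rw [reducedDen, Nat.gcd_eq_right hd]
  exact Nat.div_self (Nat.pos_of_ne_zero (fracIndex p h).1.den_nz)

/-- If q = 1, the denominator divides p, and the fraction can be rewritten with denominator p. -/
lemma two_le_reducedDen {p : ℕ} (hp : p ≠ 0) {x : PhaseIndex}
    (hx : x ∉ Set.range (fracIndex p)) : 2 ≤ reducedDen p x.1.den := by
  have h0 := reducedDen_ne_zero p x.1.den_nz
  by_contra hc
  have h1 : reducedDen p x.1.den = 1 := by omega
  rw [reducedDen] at h1
  have hdvd : x.1.den ∣ p := by
    have := Nat.mul_div_cancel' (Nat.gcd_dvd_right p x.1.den)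
    rw [h1, mul_one] at this
    rw [← this]
    exact Nat.gcd_dvd_left _ _
  obtain ⟨c, hc⟩ := hdvd
  have hp' : (0 : ℚ) < p := by exact_mod_cast Nat.pos_of_ne_zero hp
  have hnum : ((x.1.num.toNat : ℕ) : ℤ) = x.1.num := Int.toNat_of_nonneg (Rat.num_pos.2 x.2.1).le
  have hval : ((x.1.num.toNat * c : ℕ) : ℚ) / p = x.1 := by
    have h2 : ((x.1.num.toNat : ℕ) : ℚ) = x.1.num := by exact_mod_cast congrArg (Int.cast (R := ℚ)) hnum
    have hc0 : (c : ℚ) ≠ 0 := by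
      rintro h
      rw [Nat.cast_eq_zero] at h
      exact hp (by rw [hc, h, mul_zero])
    rw [Nat.cast_mul, h2]
    conv_rhs => rw [← Rat.num_div_den x.1]
    rw [hc, Nat.cast_mul, mul_div_mul_right _ _ hc0]
  have hmem : x.1.num.toNat * c ∈ Finset.Icc 1 p := by
    rw [Finset.mem_Icc]
    have h3 := x.2.1
    have h4 := x.2.2
    rw [← hval] at h3 h4
    rw [div_le_one hp'] at h4
    rw [div_pos_iff_of_pos_right hp'] at h3
    exact ⟨by exact_mod_cast h3, by exact_mod_cast h4⟩
  exact hx ⟨⟨_, hmem⟩, Subtype.ext hval⟩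

lemma fracIndex_injective {p : ℕ} (hp : p ≠ 0) : Function.Injective (fracIndex p) := by
  intro h h' hh
  have h1 := congrArg Subtype.val hh
  simp only [fracIndex] at h1
  rw [div_left_inj' (Nat.cast_ne_zero.2 hp)] at h1
  exact Subtype.ext (by exact_mod_cast h1)

lemma phaseFun_fracIndex_re {p : ℕ} (hp : 2 ≤ p) (h : Finset.Icc 1 p) {r : ℝ} (h0 : 0 ≤ r)
    (h1 : r ≤ 1) (θ : ℝ) :
    (phaseFun p (fracIndex p h) (r * exp (θ * I))).re =
      √(dilogHeight r (θ + 2 * (h : ℕ) * Real.pi / p) / (2 * p)) := by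
  rw [phaseFun_eq hp _ (by rwa [norm_polar h0]), re_cpow_half, reducedDen_fracIndex]
  have harg : exp (2 * Real.pi * ((fracIndex p h).1 : ℝ) * I) * (r * exp (θ * I)) =
      r * exp ((θ + 2 * (h : ℕ) * Real.pi / p : ℝ) * I) := by
    rw [mul_left_comm, ← exp_add]
    congr 2
    simp only [fracIndex]
    push_cast
    ring
  rw [pow_one, harg]
  have hcast : (1 / ((p : ℂ) * ((1 : ℕ) : ℂ) ^ 2)) = ((1 / p : ℝ) : ℂ) := by push_cast; simp
  rw [hcast, norm_mul, re_ofReal_mul, norm_real, Real.norm_eq_abs,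
    abs_of_nonneg (by positivity : (0 : ℝ) ≤ 1 / p), dilogHeight]
  congr 1
  field_simp

/-! ### The lower bound for the height at angle π/3. -/

lemma cos_natCast_add_three_mul (n : ℕ) :
    Real.cos (((n + 3 : ℕ) : ℝ) * (Real.pi / 3)) = -Real.cos (n * (Real.pi / 3)) := by
  rw [← Real.cos_add_pi]
  congr 1
  push_cast
  ring

lemma cos_two_pi_div_three : Real.cos (2 * (Real.pi / 3)) = -(1 / 2) := by
  rw [Real.cos_two_mul, Real.cos_pi_div_three]
  norm_num

/-- Shifting n by 3 changes the sign of the sum, so the induction has to carry both bounds. -/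
lemma cos_add_cos_ge (n : ℕ) :
    -(3 / 2) ≤ Real.cos (((n + 2 : ℕ) : ℝ) * (Real.pi / 3)) +
      Real.cos (((n + 3 : ℕ) : ℝ) * (Real.pi / 3)) ∧
    Real.cos (((n + 2 : ℕ) : ℝ) * (Real.pi / 3)) +
      Real.cos (((n + 3 : ℕ) : ℝ) * (Real.pi / 3)) ≤ 3 / 2 := by
  have h1 := Real.cos_pi_div_three
  have h2 := cos_two_pi_div_three
  have h3 : Real.cos (3 * (Real.pi / 3)) = -1 := by
    rw [show 3 * (Real.pi / 3) = Real.pi by ring, Real.cos_pi]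
  have h4 := cos_natCast_add_three_mul 1
  rw [Nat.cast_one, one_mul, h1] at h4
  have h5 := cos_natCast_add_three_mul 2
  rw [Nat.cast_ofNat, h2] at h5
  induction n using Nat.strong_induction_on with
  | _ n ih =>
    rcases n with _ | _ | _ | n
    · norm_num [h2, h3]
    · norm_num at h4 ⊢
      rw [h3, h4]; norm_num
    · norm_num at h4 h5 ⊢
      rw [h4, h5]; norm_num
    · have := ih n (by omega)
      have ha := cos_natCast_add_three_mul (n + 2)
      have hb := cos_natCast_add_three_mul (n + 3)
      rw [show n + 3 + 2 = n + 2 + 3 by ring, ha, hb]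
      constructor <;> linarith [this.1, this.2]

/-- Bounding |w| below by Re(e^{-iπ/3} w) makes the height at least a series with terms r^n/n² ·
(cos((n-1)π/3) + cos(nπ/3)), n ≥ 1. Its first bracket is 3/2, the second is 0, and the others are at
least -3/2. -/
lemma dilogHeight_pi_div_three_gt {r : ℝ} (h0 : 0 < r) (h1 : r < 1) :
    r ^ 2 * (Real.pi ^ 2 / 12) < dilogHeight r (Real.pi / 3) := by
  set w := dilog (r * exp ((Real.pi / 3 : ℝ) * I)) with hw
  have hH : dilogHeight r (Real.pi / 3) = ‖w‖ + w.re := rfl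
  have hre := hasSum_dilog_re h0.le h1.le (Real.pi / 3)
  have him := hasSum_dilog_im h0.le h1.le (Real.pi / 3)
  rw [← hw] at hre him
  have hcs := Real.sin_sq_add_cos_sq (Real.pi / 3)
  have hrot : Real.cos (Real.pi / 3) * w.re + Real.sin (Real.pi / 3) * w.im ≤ ‖w‖ := by
    refine le_of_sq_le_sq ?_ (norm_nonneg _)
    rw [Complex.sq_norm, normSq_apply]
    have h2 := sq_nonneg (Real.sin (Real.pi / 3) * w.re - Real.cos (Real.pi / 3) * w.im)
    have h3 : w.re * w.re + w.im * w.im =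
      (Real.sin (Real.pi / 3) ^ 2 + Real.cos (Real.pi / 3) ^ 2) * (w.re * w.re + w.im * w.im) := by
      rw [hcs, one_mul]
    rw [h3]
    nlinarith
  have hsum := ((hre.mul_left (Real.cos (Real.pi / 3))).add
    (him.mul_left (Real.sin (Real.pi / 3)))).add hre
  have hsum' : HasSum (fun n : ℕ => r ^ (n + 1) / ((n : ℝ) + 1) ^ 2 *
      (Real.cos (n * (Real.pi / 3)) + Real.cos ((n + 1 : ℕ) * (Real.pi / 3))))
      (Real.cos (Real.pi / 3) * w.re + Real.sin (Real.pi / 3) * w.im + w.re) := by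
    refine hsum.congr_fun fun n => ?_
    have : (n : ℝ) * (Real.pi / 3) = (n + 1 : ℕ) * (Real.pi / 3) - Real.pi / 3 := by
      push_cast; ring
    rw [this, Real.cos_sub]
    ring
  have htail := (hasSum_nat_add_iff' 2).2 hsum'
  have hz := ((hasSum_nat_add_iff' 2).2 hasSum_one_div_succ_sq).mul_left (-(3 / 2) * r)
  have hle := hasSum_le (fun n => ?_) hz htail
  · generalize Real.cos (Real.pi / 3) * w.re + Real.sin (Real.pi / 3) * w.im = A at hrot hle
    -- The tail of ∑ 1/n² from n = 3 is π²/6 - 5/4, so the height is at least r(27/8 - π²/4). As r²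
    -- < r, the claim follows from π² < 81/8.
    simp only [Finset.sum_range_succ, Finset.range_zero, Finset.sum_empty] at hle
    norm_num [Real.cos_pi_div_three, cos_two_pi_div_three] at hle
    have hpi : Real.pi ^ 2 < 10 := by nlinarith [Real.pi_lt_d2, Real.pi_pos]
    rw [hH]
    nlinarith [mul_pos h0 (sub_pos.2 hpi),
      mul_nonneg (mul_pos h0 (sub_pos.2 h1)).le (sq_nonneg Real.pi)]
  · have hc := (cos_add_cos_ge n).1
    have hpow : r ^ (n + 2 + 1) ≤ r := by
      rw [pow_succ]
      exact mul_le_of_le_one_left h0.le (pow_le_one₀ h0.le h1.le)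
    have hA : 0 ≤ r ^ (n + 2 + 1) / (((n + 2 : ℕ) : ℝ) + 1) ^ 2 := by positivity
    calc -(3 / 2) * r * (1 / (((n + 2 : ℕ) : ℝ) + 1) ^ 2)
        = r / (((n + 2 : ℕ) : ℝ) + 1) ^ 2 * (-(3 / 2)) := by ring
      _ ≤ r ^ (n + 2 + 1) / (((n + 2 : ℕ) : ℝ) + 1) ^ 2 * (-(3 / 2)) := by
        refine mul_le_mul_of_nonpos_right ?_ (by norm_num)
        gcongr
      _ ≤ _ := mul_le_mul_of_nonneg_left hc hA

/-! ### Existence of the maximum over all other fractions. -/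

lemma exists_isGreatest_of_finite_superlevel {ι : Type*} [Nontrivial ι] (f : ι → ℝ)
    (hf : ∀ i, 0 ≤ f i)
    (hfin : ∀ ε : ℝ, 0 < ε → {i | ε ≤ f i}.Finite) (m : ι) :
    ∃ M : ℝ, IsGreatest {x : ℝ | ∃ n : ι, n ≠ m ∧ x = f n} M := by
  by_cases hz : ∀ n, n ≠ m → f n = 0
  · obtain ⟨n, hn⟩ := exists_ne m
    refine ⟨0, ⟨n, hn, (hz n hn).symm⟩, ?_⟩
    rintro x ⟨i, hi, rfl⟩
    exact (hz i hi).le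
  · push Not at hz
    obtain ⟨n₀, hn₀, hne⟩ := hz
    have hpos : 0 < f n₀ := lt_of_le_of_ne (hf n₀) hne.symm
    obtain ⟨a, ha, hmax⟩ := Set.exists_max_image {i | i ≠ m ∧ f n₀ ≤ f i} f
      ((hfin _ hpos).subset fun i hi => hi.2) ⟨n₀, hn₀, le_rfl⟩
    refine ⟨f a, ⟨a, ha.1, rfl⟩, ?_⟩
    rintro x ⟨i, hi, rfl⟩
    by_cases h : f n₀ ≤ f i
    · exact hmax i ⟨hi, h⟩
    · exact (not_le.1 h).le.trans ha.2

instance : Nontrivial PhaseIndex :=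
  ⟨⟨⟨1, by norm_num⟩, ⟨1 / 2, by norm_num⟩, by simp⟩⟩

lemma finite_setOf_den_le (N : ℕ) : {x : PhaseIndex | x.1.den ≤ N}.Finite := by
  have hfin : ((fun q : ℕ × ℕ => (q.1 : ℚ) / q.2) '' (Set.Iic N ×ˢ Set.Iic N)).Finite :=
    ((Set.finite_Iic N).prod (Set.finite_Iic N)).image _
  refine (hfin.preimage (Subtype.val_injective.injOn)).subset fun x hx => ?_
  have hnum : ((x.1.num.toNat : ℕ) : ℤ) = x.1.num := Int.toNat_of_nonneg (Rat.num_pos.2 x.2.1).le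
  have hle : x.1.num ≤ x.1.den := by
    have h := x.2.2
    rw [← Rat.num_div_den x.1, div_le_one (by exact_mod_cast x.1.den_pos)] at h
    exact_mod_cast h
  refine ⟨(x.1.num.toNat, x.1.den), ⟨?_, hx⟩, ?_⟩
  · simp only [Set.mem_Iic]
    have : x.1.den ≤ N := hx
    omega
  · have h2 : ((x.1.num.toNat : ℕ) : ℚ) = x.1.num := by
      exact_mod_cast congrArg (Int.cast (R := ℚ)) hnum
    simp only [h2]
    exact Rat.num_div_den x.1

/-- The values decay like the inverse of the denominator, so only finitely many functions exceed a
given ε > 0 at z and the maximum in `Dominates` is attained. -/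
lemma phaseFun_re_mul_den_le {p : ℕ} (hp : 2 ≤ p) (x : PhaseIndex) {z : ℂ} (hz : ‖z‖ ≤ 1) :
    (phaseFun p x z).re * x.1.den ≤ p := by
  have h := phaseFun_re_sq_le hp x hz
  have h0 := phaseFun_re_nonneg (p := p) x z
  set q := reducedDen p x.1.den
  have hq : (1 : ℝ) ≤ q := by
    exact_mod_cast Nat.one_le_iff_ne_zero.2 (reducedDen_ne_zero p x.1.den_nz)
  have hden : (x.1.den : ℝ) ≤ p * q := by
    exact_mod_cast le_mul_reducedDen (by omega) x.1.den
  have hp' : (2 : ℝ) ≤ p := by exact_mod_cast hp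
  have hpi : Real.pi ^ 2 / 6 ≤ 2 := by nlinarith [Real.pi_lt_d2, Real.pi_pos]
  have hzq : ‖z‖ ^ q * (Real.pi ^ 2 / 6) ≤ 1 * 2 := by
    gcongr
    exact pow_le_one₀ (norm_nonneg _) hz
  have h1 : ((phaseFun p x z).re * q) ^ 2 ≤ 1 ^ 2 := by
    calc ((phaseFun p x z).re * q) ^ 2 = (phaseFun p x z).re ^ 2 * q ^ 2 := by ring
      _ ≤ (1 / ((p : ℝ) * (q : ℝ) ^ 2) * (1 * 2)) * q ^ 2 := by
        gcongr
        exact h.trans (by gcongr)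
      _ = 2 / p := by field_simp
      _ ≤ 1 ^ 2 := by rw [one_pow, div_le_one (by linarith)]; exact hp'
  have h2 : (phaseFun p x z).re * q ≤ 1 := le_of_sq_le_sq h1 zero_le_one
  calc (phaseFun p x z).re * x.1.den ≤ (phaseFun p x z).re * (p * q) := by gcongr
    _ = p * ((phaseFun p x z).re * q) := by ring
    _ ≤ p * 1 := by gcongr
    _ = p := mul_one _

lemma dominates_phaseFun_iff {p : ℕ} (hp : 2 ≤ p) (x : PhaseIndex) {z : ℂ} (hz : ‖z‖ ≤ 1) :
    Dominates (phaseFun p) x z ↔ ∀ y, y ≠ x → (phaseFun p y z).re < (phaseFun p x z).re := by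
  constructor
  · rintro ⟨M, hM, hlt⟩ y hy
    exact (hM.2 ⟨y, hy, rfl⟩).trans_lt hlt
  · intro h
    obtain ⟨M, hM⟩ := exists_isGreatest_of_finite_superlevel (fun y => (phaseFun p y z).re)
      (fun y => phaseFun_re_nonneg y z) (fun ε hε => by
        refine (finite_setOf_den_le ⌊(p : ℝ) / ε⌋₊).subset fun y hy => ?_
        refine Nat.le_floor ?_
        rw [le_div_iff₀ hε, mul_comm]
        refine le_trans ?_ (phaseFun_re_mul_den_le hp y hz)
        exact mul_le_mul_of_nonneg_right hy (Nat.cast_nonneg _)) x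
    obtain ⟨y, hy, hMy⟩ := hM.1
    exact ⟨M, hM, by rw [hMy]; exact h y hy⟩

/-- All the functions vanish at the origin, so none is strictly largest there. -/
lemma not_dominates_phaseFun_zero {p : ℕ} (hp : 2 ≤ p) (x : PhaseIndex) :
    ¬ Dominates (phaseFun p) x 0 := by
  have h0 : ∀ y, phaseFun p y 0 = 0 := by
    intro y
    rw [phaseFun_eq hp y (by simp), mul_zero, zero_pow (reducedDen_ne_zero p y.1.den_nz),
      dilog_zero, mul_zero, zero_cpow (by norm_num)]
  rw [dominates_phaseFun_iff hp x (by simp)]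
  intro h
  obtain ⟨y, hy⟩ := exists_ne x
  have := h y hy
  rw [h0, h0] at this
  exact lt_irrefl _ this

/-! ### Angles and the nearest sector. -/

/-- Every integer is congruent to an element of `{1, …, p}`. -/
lemma exists_mem_Icc_add_mul {p : ℕ} (hp : p ≠ 0) (m : ℤ) :
    ∃ (h : Finset.Icc 1 p) (n : ℤ), ((h : ℕ) : ℤ) = m + p * n := by
  have hp' : (0 : ℤ) < p := by exact_mod_cast Nat.pos_of_ne_zero hp
  have h1 := Int.emod_nonneg (m - 1) hp'.ne'
  have h2 := Int.emod_lt_of_pos (m - 1) hp'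
  have h3 := Int.emod_add_mul_ediv (m - 1) p
  have h4 : (((m - 1) % p + 1).toNat : ℤ) = (m - 1) % p + 1 := Int.toNat_of_nonneg (by omega)
  refine ⟨⟨((m - 1) % p + 1).toNat, Finset.mem_Icc.2 ⟨by omega, by omega⟩⟩, -((m - 1) / p), ?_⟩
  simp only [h4]
  linear_combination h3

/-- Every nonzero number has an argument close to the center of one of the `p` sectors. -/
lemma exists_polar_near {p : ℕ} (hp : p ≠ 0) (z : ℂ) :
    ∃ (h : Finset.Icc 1 p) (θ : ℝ), z = (‖z‖ : ℂ) * exp (θ * I) ∧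
      |θ + 2 * (h : ℕ) * Real.pi / p| ≤ Real.pi / p := by
  have hp' : (0 : ℝ) < p := by exact_mod_cast Nat.pos_of_ne_zero hp
  -- In units of 2π/p the sector centers are the integers -h, so h is taken congruent to minus the
  -- rounded argument.
  set y : ℝ := z.arg * p / (2 * Real.pi) with hy
  obtain ⟨h, n, hn⟩ := exists_mem_Icc_add_mul hp (-round y)
  refine ⟨h, z.arg - 2 * Real.pi * n, ?_, ?_⟩
  · have : exp (((z.arg - 2 * Real.pi * n : ℝ) : ℂ) * I) = exp (z.arg * I) := by
      rw [exp_eq_exp_iff_exists_int]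
      exact ⟨-n, by push_cast; ring⟩
    rw [this, norm_mul_exp_arg_mul_I]
  · have hh : ((h : ℕ) : ℝ) = -round y + p * n := by exact_mod_cast hn
    have h1 : z.arg - 2 * Real.pi * n + 2 * (h : ℕ) * Real.pi / p =
        (2 * Real.pi / p) * (y - round y) := by
      rw [hh, hy]
      have := Real.pi_ne_zero
      field_simp
      ring
    have h2 : 0 < 2 * Real.pi / p := by positivity
    rw [h1, abs_mul, abs_of_pos h2]
    calc 2 * Real.pi / p * |y - round y| ≤ 2 * Real.pi / p * (1 / 2) := by
          gcongr
          exact abs_sub_round y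
      _ = Real.pi / p := by ring

/-- The difference of the cosines is 2 sin(φ + a) sin a, and both angles lie in (0, π). -/
lemma cos_add_lt_of_pos {c a φ : ℝ} (ha : c ≤ a) (hc : 0 < c) (ha' : a + c ≤ Real.pi)
    (hφ : |φ| < c) : Real.cos (φ + 2 * a) < Real.cos φ := by
  have h := abs_lt.1 hφ
  have h1 := Real.sin_pos_of_pos_of_lt_pi (x := a) (by linarith) (by linarith)
  have h2 := Real.sin_pos_of_pos_of_lt_pi (x := φ + a) (by linarith) (by linarith)
  have h3 := Real.cos_sub_cos φ (φ + 2 * a)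
  rw [show (φ + (φ + 2 * a)) / 2 = φ + a by ring, show (φ - (φ + 2 * a)) / 2 = -a by ring,
    Real.sin_neg] at h3
  nlinarith [mul_pos h1 h2]

lemma cos_sector_lt {p : ℕ} (h h' : Finset.Icc 1 p) (hne : h' ≠ h) {θ : ℝ}
    (hθ : |θ + 2 * (h : ℕ) * Real.pi / p| < Real.pi / p) :
    Real.cos (θ + 2 * (h' : ℕ) * Real.pi / p) < Real.cos (θ + 2 * (h : ℕ) * Real.pi / p) := by
  obtain ⟨h1, h2⟩ := Finset.mem_Icc.1 h.2
  obtain ⟨h1', h2'⟩ := Finset.mem_Icc.1 h'.2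
  have hp : (0 : ℝ) < p := by exact_mod_cast (by omega : 0 < p)
  have hne' : (h' : ℕ) ≠ h := fun hc => hne (Subtype.ext hc)
  have hbound : ∀ m n : ℕ, 1 ≤ m → m < n → n ≤ p →
      Real.pi / p ≤ ((n : ℝ) - m) * Real.pi / p ∧
        ((n : ℝ) - m) * Real.pi / p + Real.pi / p ≤ Real.pi := by
    intro m n hm hmn hn
    have e1 : (1 : ℝ) ≤ m := by exact_mod_cast hm
    have e2 : (m : ℝ) + 1 ≤ n := by exact_mod_cast hmn
    have e3 : (n : ℝ) ≤ p := by exact_mod_cast hn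
    constructor
    · gcongr
      nlinarith [Real.pi_pos]
    · rw [← add_div, div_le_iff₀ hp]
      nlinarith [Real.pi_pos]
  have hc : 0 < Real.pi / p := by positivity
  rcases lt_or_gt_of_ne hne' with hlt | hlt
  · obtain ⟨b1, b2⟩ := hbound _ _ h1' hlt h2
    have := cos_add_lt_of_pos b1 hc b2 (φ := -(θ + 2 * (h : ℕ) * Real.pi / p)) (by rwa [abs_neg])
    rw [Real.cos_neg, ← Real.cos_neg] at this
    convert this using 2
    ring
  · obtain ⟨b1, b2⟩ := hbound _ _ h1 hlt h2'
    have := cos_add_lt_of_pos b1 hc b2 hθ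
    convert this using 2
    ring

lemma cos_sector_le {p : ℕ} (h h' : Finset.Icc 1 p) {θ : ℝ}
    (hθ : |θ + 2 * (h : ℕ) * Real.pi / p| ≤ Real.pi / p) :
    Real.cos (θ + 2 * (h' : ℕ) * Real.pi / p) ≤ Real.cos (θ + 2 * (h : ℕ) * Real.pi / p) := by
  rcases eq_or_ne h' h with rfl | hne
  · exact le_rfl
  obtain ⟨h1, h2⟩ := Finset.mem_Icc.1 h.2
  have hp : (0 : ℝ) < p := by exact_mod_cast (by omega : 0 < p)
  have hc : (0 : ℝ) < Real.pi / p := by positivity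
  have hmem : θ ∈ closure (Set.Ioo (-(2 * (h : ℕ) * Real.pi / p) - Real.pi / p)
      (-(2 * (h : ℕ) * Real.pi / p) + Real.pi / p)) := by
    rw [closure_Ioo (by linarith)]
    have := abs_le.1 hθ
    exact ⟨by linarith [this.1], by linarith [this.2]⟩
  refine closure_minimal (t := {t : ℝ | Real.cos (t + 2 * (h' : ℕ) * Real.pi / p) ≤
    Real.cos (t + 2 * (h : ℕ) * Real.pi / p)}) (fun t ht => ?_)
    (isClosed_le (by fun_prop) (by fun_prop)) hmem
  exact (cos_sector_lt h h' hne (abs_lt.2 ⟨by linarith [ht.1], by linarith [ht.2]⟩)).le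

/-- On an edge, passing to the neighbouring center reflects the angle ±π/p to ∓π/p. This is why the
edges belong to no region. -/
lemma exists_ne_cos_eq_of_boundary {p : ℕ} (hp : 2 ≤ p) (h : Finset.Icc 1 p) {θ : ℝ}
    (hθ : |θ + 2 * (h : ℕ) * Real.pi / p| = Real.pi / p) :
    ∃ h' : Finset.Icc 1 p, h' ≠ h ∧
      Real.cos (θ + 2 * (h' : ℕ) * Real.pi / p) = Real.cos (θ + 2 * (h : ℕ) * Real.pi / p) := by
  have hp' : (0 : ℝ) < p := by exact_mod_cast (by omega : 0 < p)
  have key : ∀ s : ℤ, |s| = 1 → θ + 2 * (h : ℕ) * Real.pi / p = -(s * (Real.pi / p)) →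
      ∃ h' : Finset.Icc 1 p, h' ≠ h ∧
      Real.cos (θ + 2 * (h' : ℕ) * Real.pi / p) = Real.cos (θ + 2 * (h : ℕ) * Real.pi / p) := by
    intro s hs hθs
    obtain ⟨h', n, hn⟩ := exists_mem_Icc_add_mul (by omega : p ≠ 0) (((h : ℕ) : ℤ) + s)
    refine ⟨h', ?_, ?_⟩
    · rintro rfl
      have hd : (p : ℤ) ∣ s := ⟨-n, by linear_combination -hn⟩
      have h2 := Int.le_of_dvd (by rw [hs]; norm_num) ((dvd_abs _ _).2 hd)
      omega
    · have hh : ((h' : ℕ) : ℝ) = (h : ℕ) + s + p * n := by exact_mod_cast hn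
      have : θ + 2 * (h' : ℕ) * Real.pi / p = s * (Real.pi / p) + n * (2 * Real.pi) := by
        have e : θ + 2 * (h' : ℕ) * Real.pi / p =
            (θ + 2 * (h : ℕ) * Real.pi / p) + 2 * s * (Real.pi / p) + n * (2 * Real.pi) := by
          rw [hh]; field_simp; ring
        rw [e, hθs]; ring
      rw [this, Real.cos_add_int_mul_two_pi, hθs, Real.cos_neg]
  rcases (abs_eq (by positivity : (0 : ℝ) ≤ Real.pi / p)).1 hθ with h1 | h1
  · exact key (-1) (by simp) (by rw [h1]; push_cast; ring)
  · exact key 1 (by simp) (by rw [h1]; push_cast; ring)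

/-! ### Comparison of the phase functions at a point. -/

section Comparison

variable {p : ℕ} {r θ : ℝ}

lemma phaseFun_fracIndex_re_lt (hp : 2 ≤ p) (h0 : 0 < r) (h1 : r < 1) {h h' : Finset.Icc 1 p}
    (hcos : Real.cos (θ + 2 * (h' : ℕ) * Real.pi / p) < Real.cos (θ + 2 * (h : ℕ) * Real.pi / p)) :
    (phaseFun p (fracIndex p h') (r * exp (θ * I))).re <
      (phaseFun p (fracIndex p h) (r * exp (θ * I))).re := by
  have hp' : (0 : ℝ) < p := by exact_mod_cast (by omega : 0 < p)
  rw [phaseFun_fracIndex_re hp h' h0.le h1.le, phaseFun_fracIndex_re hp h h0.le h1.le]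
  refine Real.sqrt_lt_sqrt (div_nonneg (dilogHeight_nonneg _ _) (by positivity)) ?_
  exact div_lt_div_of_pos_right (dilogHeight_lt_of_cos_lt hcos h0 h1) (by positivity)

lemma phaseFun_fracIndex_re_le (hp : 2 ≤ p) (h0 : 0 < r) (h1 : r < 1) {h h' : Finset.Icc 1 p}
    (hcos : Real.cos (θ + 2 * (h' : ℕ) * Real.pi / p) ≤ Real.cos (θ + 2 * (h : ℕ) * Real.pi / p)) :
    (phaseFun p (fracIndex p h') (r * exp (θ * I))).re ≤
      (phaseFun p (fracIndex p h) (r * exp (θ * I))).re := by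
  rw [phaseFun_fracIndex_re hp h' h0.le h1.le, phaseFun_fracIndex_re hp h h0.le h1.le]
  refine Real.sqrt_le_sqrt (div_le_div_of_nonneg_right ?_ (by positivity))
  exact dilogHeight_le_of_cos_le hcos h0 h1

lemma phaseFun_re_lt_of_not_mem_range (hp : 3 ≤ p) (h0 : 0 < r) (h1 : r < 1)
    {h : Finset.Icc 1 p} (hθ : |θ + 2 * (h : ℕ) * Real.pi / p| ≤ Real.pi / p) {x : PhaseIndex}
    (hx : x ∉ Set.range (fracIndex p)) :
    (phaseFun p x (r * exp (θ * I))).re <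
      (phaseFun p (fracIndex p h) (r * exp (θ * I))).re := by
  have hp2 : 2 ≤ p := by omega
  have hp' : (3 : ℝ) ≤ p := by exact_mod_cast hp
  have hnorm := norm_polar h0.le θ
  have hsq := phaseFun_re_sq_le hp2 x (z := r * exp (θ * I)) (by rw [hnorm]; exact h1.le)
  rw [hnorm] at hsq
  have hq := two_le_reducedDen (by omega : p ≠ 0) hx
  set q := reducedDen p x.1.den
  have hq' : (2 : ℝ) ≤ q := by exact_mod_cast hq
  rw [phaseFun_fracIndex_re hp2 h h0.le h1.le]
  refine Real.lt_sqrt_of_sq_lt (hsq.trans_lt ?_)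
  have hpi3 : Real.pi / p ≤ Real.pi / 3 := by gcongr
  have hcos : Real.cos (Real.pi / 3) ≤ Real.cos (θ + 2 * (h : ℕ) * Real.pi / p) := by
    rw [← Real.cos_abs (θ + _)]
    exact Real.cos_le_cos_of_nonneg_of_le_pi (abs_nonneg _) (by linarith [Real.pi_pos])
      (hθ.trans hpi3)
  have hH := (dilogHeight_pi_div_three_gt h0 h1).trans_le (dilogHeight_le_of_cos_le hcos h0 h1)
  -- The upper bound is largest at q = 2, where it equals the bound from angle π/3; strictness comes
  -- from `hH`.
  calc 1 / ((p : ℝ) * (q : ℝ) ^ 2) * (r ^ q * (Real.pi ^ 2 / 6))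
      ≤ 1 / ((p : ℝ) * 2 ^ 2) * (r ^ 2 * (Real.pi ^ 2 / 6)) := by
        gcongr ?_ * (?_ * _)
        · gcongr
        · exact pow_le_pow_of_le_one h0.le h1.le hq
    _ = r ^ 2 * (Real.pi ^ 2 / 12) / (2 * p) := by field_simp; norm_num
    _ < _ := by gcongr

end Comparison

/-! ### The regions as sectors, their closures and the maximal phase family. -/

lemma phaseRegion_fracIndex {p : ℕ} (hp : 3 ≤ p) (h : Finset.Icc 1 p) :
    phaseRegion p (fracIndex p h) =
      sector (-(2 * ((h : ℕ) : ℝ) * Real.pi / (p : ℝ))) (2 * Real.pi / (p : ℝ)) := by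
  have hp2 : 2 ≤ p := by omega
  have hp0 : p ≠ 0 := by omega
  have hhalf : 2 * Real.pi / p / 2 = Real.pi / p := by ring
  ext z
  constructor
  · rintro ⟨hz1, hz0, hd⟩
    rw [mem_ball_zero_iff] at hz1
    rw [dominates_phaseFun_iff hp2 _ hz1.le] at hd
    obtain ⟨h', θ, hz, hθ⟩ := exists_polar_near hp0 z
    have hr : 0 < ‖z‖ := norm_pos_iff.2 hz0
    rw [hz] at hd
    obtain rfl : h' = h := by
      by_contra hne
      exact (hd _ ((fracIndex_injective hp0).ne hne)).not_ge
        (phaseFun_fracIndex_re_le hp2 hr hz1 (cos_sector_le h' h hθ))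
    refine ⟨‖z‖, θ, hr, hz1, ?_, hz⟩
    rw [sub_neg_eq_add, hhalf]
    refine lt_of_le_of_ne hθ fun hb => ?_
    obtain ⟨h'', hne, hcos⟩ := exists_ne_cos_eq_of_boundary hp2 h' hb
    exact (hd _ ((fracIndex_injective hp0).ne hne)).not_ge
      (phaseFun_fracIndex_re_le hp2 hr hz1 hcos.ge)
  · rintro ⟨r, θ, h0, h1, hθ, rfl⟩
    rw [sub_neg_eq_add, hhalf] at hθ
    have hnorm := norm_polar h0.le θ
    refine ⟨by rw [mem_ball_zero_iff, hnorm]; exact h1, ?_, ?_⟩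
    · rw [← norm_pos_iff, hnorm]; exact h0
    · rw [dominates_phaseFun_iff hp2 _ (by rw [hnorm]; exact h1.le)]
      intro y hy
      by_cases hyr : y ∈ Set.range (fracIndex p)
      · obtain ⟨h', rfl⟩ := hyr
        exact phaseFun_fracIndex_re_lt hp2 h0 h1
          (cos_sector_lt h h' (fun hc => hy (hc ▸ rfl)) hθ)
      · exact phaseFun_re_lt_of_not_mem_range hp h0 h1 hθ.le hyr

lemma exists_phaseFun_re_lt {p : ℕ} (hp : 3 ≤ p) {x : PhaseIndex}
    (hx : x ∉ Set.range (fracIndex p)) {z : ℂ} (hz1 : z ∈ Metric.ball (0 : ℂ) 1) (hz0 : z ≠ 0) :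
    ∃ h : Finset.Icc 1 p, (phaseFun p x z).re < (phaseFun p (fracIndex p h) z).re := by
  obtain ⟨h, θ, hz, hθ⟩ := exists_polar_near (by omega : p ≠ 0) z
  rw [mem_ball_zero_iff] at hz1
  refine ⟨h, ?_⟩
  rw [hz]
  exact phaseFun_re_lt_of_not_mem_range hp (norm_pos_iff.2 hz0) hz1 hθ hx

lemma phaseRegion_eq_empty {p : ℕ} (hp : 3 ≤ p) {x : PhaseIndex}
    (hx : x ∉ Set.range (fracIndex p)) : phaseRegion p x = ∅ := by
  rw [Set.eq_empty_iff_forall_notMem]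
  rintro z ⟨hz1, hz0, hd⟩
  obtain ⟨h, hh⟩ := exists_phaseFun_re_lt hp hx hz1 hz0
  rw [dominates_phaseFun_iff (by omega) _ (mem_ball_zero_iff.1 hz1).le] at hd
  exact (hd _ fun hc => hx ⟨h, hc⟩).not_gt hh

lemma mem_closure_sector {c α r θ : ℝ} (hα : 0 < α) (h0 : 0 ≤ r) (h1 : r ≤ 1)
    (hθ : |θ - c| ≤ α / 2) : (r : ℂ) * exp (θ * I) ∈ closure (sector c α) := by
  let f : ℝ × ℝ → ℂ := fun q => (q.1 : ℂ) * exp (q.2 * I)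
  have hf : Continuous f := by fun_prop
  have hsub : f '' (Set.Ioo 0 1 ×ˢ Set.Ioo (c - α / 2) (c + α / 2)) ⊆ sector c α := by
    rintro _ ⟨⟨s, t⟩, ⟨hs, ht⟩, rfl⟩
    exact ⟨s, t, hs.1, hs.2, abs_lt.2 ⟨by linarith [ht.1], by linarith [ht.2]⟩, rfl⟩
  refine closure_mono hsub (image_closure_subset_closure_image hf ⟨(r, θ), ?_, rfl⟩)
  rw [closure_prod_eq, closure_Ioo zero_ne_one, closure_Ioo (by linarith)]
  have := abs_le.1 hθ
  exact ⟨⟨h0, h1⟩, ⟨by linarith [this.1], by linarith [this.2]⟩⟩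

lemma closedBall_eq_iUnion_closure_phaseRegion {p : ℕ} (hp : 3 ≤ p) :
    Metric.closedBall (0 : ℂ) 1 =
      ⋃ h : Finset.Icc 1 p, closure (phaseRegion p (fracIndex p h)) := by
  have hp' : (0 : ℝ) < p := by exact_mod_cast (by omega : 0 < p)
  refine Set.Subset.antisymm (fun z hz => ?_) (Set.iUnion_subset fun h => ?_)
  · rw [mem_closedBall_zero_iff] at hz
    obtain ⟨h, θ, hzθ, hθ⟩ := exists_polar_near (by omega : p ≠ 0) z
    refine Set.mem_iUnion.2 ⟨h, ?_⟩
    rw [phaseRegion_fracIndex hp, hzθ]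
    refine mem_closure_sector (by positivity) (norm_nonneg _) hz ?_
    rw [sub_neg_eq_add]
    exact hθ.trans_eq (by ring)
  · refine closure_minimal (fun z hz => ?_) Metric.isClosed_closedBall
    exact Metric.ball_subset_closedBall hz.1

lemma isPhaseFamily_le_phaseRegion {p : ℕ} (hp : 2 ≤ p) {R : PhaseIndex → Set ℂ}
    (hR : IsPhaseFamily (phaseFun p) (Metric.ball (0 : ℂ) 1) R) : R ≤ phaseRegion p := by
  intro x z hz
  refine ⟨hR.subset x hz, ?_, hR.dominates x z hz⟩
  rintro rfl
  exact not_dominates_phaseFun_zero hp x (hR.dominates x 0 hz)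

/-- The sector is the image of an open half-strip under the open map exp. -/
lemma isOpen_sector (c α : ℝ) : IsOpen (sector c α) := by
  have h : sector c α = exp '' {w : ℂ | w.re < 0 ∧ |w.im - c| < α / 2} := by
    ext z
    constructor
    · rintro ⟨r, θ, h0, h1, hθ, rfl⟩
      refine ⟨(Real.log r : ℝ) + θ * I, ⟨?_, ?_⟩, ?_⟩
      · simpa using Real.log_neg h0 h1
      · simpa using hθ
      · rw [exp_add, ← ofReal_exp, Real.exp_log h0]
    · rintro ⟨w, ⟨h1, h2⟩, rfl⟩
      refine ⟨Real.exp w.re, w.im, Real.exp_pos _, (by simpa using Real.exp_lt_exp.2 h1), h2, ?_⟩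
      rw [ofReal_exp, ← exp_add, re_add_im]
  rw [h]
  refine isOpenMap_exp _ (IsOpen.inter ?_ ?_)
  · exact isOpen_lt continuous_re continuous_const
  · exact isOpen_lt (continuous_im.sub continuous_const).abs continuous_const

lemma isPhaseFamily_phaseRegion {p : ℕ} (hp : 3 ≤ p) :
    IsPhaseFamily (phaseFun p) (Metric.ball (0 : ℂ) 1) (phaseRegion p) where
  finite := by
    refine (Set.finite_range (fracIndex p)).subset fun x hx => ?_
    by_contra hc
    exact hx.ne_empty (phaseRegion_eq_empty hp hc)
  isOpen x := by
    by_cases hx : x ∈ Set.range (fracIndex p)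
    · obtain ⟨h, rfl⟩ := hx
      rw [phaseRegion_fracIndex hp]
      exact isOpen_sector _ _
    · rw [phaseRegion_eq_empty hp hx]
      exact isOpen_empty
  subset x z hz := hz.1
  disjoint x y hxy := by
    refine Set.disjoint_left.2 ?_
    rintro z ⟨hz, -, hx⟩ ⟨-, -, hy⟩
    rw [dominates_phaseFun_iff (by omega) _ (mem_ball_zero_iff.1 hz).le] at hx hy
    exact (hx y hxy.symm).not_gt (hy x hxy)
  cover z hz := by
    have hz' := Metric.ball_subset_closedBall hz
    rw [closedBall_eq_iUnion_closure_phaseRegion hp] at hz'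
    obtain ⟨h, hh⟩ := Set.mem_iUnion.1 hz'
    rw [closure_eq_self_union_frontier] at hh
    exact Set.mem_iUnion.2 ⟨_, hh⟩
  dominates x z hz := hz.2.2

lemma arePhases_phaseFun_iff {p : ℕ} (hp : 3 ≤ p) (R : PhaseIndex → Set ℂ) :
    ArePhases (phaseFun p) (Metric.ball (0 : ℂ) 1) R ↔ R = phaseRegion p := by
  have hp2 : 2 ≤ p := by omega
  constructor
  · intro hR
    exact hR.eq_of_le (isPhaseFamily_phaseRegion hp) (isPhaseFamily_le_phaseRegion hp2 hR.prop)
  · rintro rfl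
    exact ⟨isPhaseFamily_phaseRegion hp, fun S hS _ => isPhaseFamily_le_phaseRegion hp2 hS⟩

end PartitionPhases

end

theorem mainTheorem7 (p : ℕ) (hp : 3 ≤ p) :
    (∀ h : Finset.Icc 1 p,
      PartitionPhases.phaseRegion p (PartitionPhases.fracIndex p h) =
        PartitionPhases.sector (-(2 * ((h : ℕ) : ℝ) * Real.pi / (p : ℝ)))
          (2 * Real.pi / (p : ℝ))) ∧
    (Metric.closedBall (0 : ℂ) 1 =
      ⋃ h : Finset.Icc 1 p,
        closure (PartitionPhases.phaseRegion p (PartitionPhases.fracIndex p h))) ∧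
    (∀ x : PartitionPhases.PhaseIndex, x ∉ Set.range (PartitionPhases.fracIndex p) →
      PartitionPhases.phaseRegion p x = ∅ ∧
      ∀ z : ℂ, z ∈ Metric.ball (0 : ℂ) 1 → z ≠ 0 →
        ∃ h : Finset.Icc 1 p, (PartitionPhases.phaseFun p x z).re <
          (PartitionPhases.phaseFun p (PartitionPhases.fracIndex p h) z).re) ∧
    (∀ R : PartitionPhases.PhaseIndex → Set ℂ,
      PartitionPhases.ArePhases (PartitionPhases.phaseFun p) (Metric.ball (0 : ℂ) 1) R ↔
        R = PartitionPhases.phaseRegion p) := by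
  exact ⟨PartitionPhases.phaseRegion_fracIndex hp,
    PartitionPhases.closedBall_eq_iUnion_closure_phaseRegion hp,
    fun _ hx => ⟨PartitionPhases.phaseRegion_eq_empty hp hx,
      fun _ hz1 hz0 => PartitionPhases.exists_phaseFun_re_lt hp hx hz1 hz0⟩,
    PartitionPhases.arePhases_phaseFun_iff hp⟩
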